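/- Consider the (deterministic, synchronous) Congested Clique model with $n$ nodes $v_1,\dots,v_n$. Each node knows $n$, its own index and its own input; in every round each node may send to every other node one message of $O(\log n)$ bits, messages to different nodes may differ, and local computation is free. Let $A$ be an array of $O(n^2)$ integers, each of size $O(\log n)$ bits, that is partitioned into $n$ consecutive (possibly empty) subarrays $A=A_1A_2\cdots A_n$, each of length $O(n)$, where node $v_t$ holds $A_t$. In addition, every node has $O(n)$ range minimum queries, each of which is a pair $(i,j)$ of positions with $1\le i\le j\le |A|$; the answer to the query is $\mathsf{RMQ}_A(i,j)=\min\{A[k] : i\le k\le j\}$. Then there is an algorithm that computes, for each node, the results of all of its queries in $O(1)$ rounds. Explicitly: write $L_n=\lfloor\log_2 n\rfloor+1$ for $n\ge 1$. For all natural numbers $a,q,w$ and $\beta\ge 1$ there is a natural number $R$ such that for every $n$ there is a Congested Clique algorithm on $n$ nodes, with messages of $\beta L_n$ bits, with the following property: whenever every node holds at most $an$ entries of $A$ and has at most $qn$ queries, and every entry $y$ of $A$ satisfies $|y|<2^{wL_n}$, then after $R$ rounds every node outputs the list of the answers to its queries, in the order of the queries. -/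

import Mathlib

/-- The number of bits of the binary representation of `n`, i.e. `⌊log₂ n⌋ + 1`. This is the
unit in which sizes `O(log n)` are measured. -/
def wordBits (n : ℕ) : ℕ := Nat.log 2 n + 1

/-- A deterministic algorithm in the Congested Clique model with nodes `Fin n` and messages of
`b` bits. Each node knows `n`, its own name and its own input. Communication is
synchronous: in each round a node sends to each node a message of exactly `b` bits, which may
differ from recipient to recipient, and then updates its state from the messages that it
received. Local computation is free and local memory is unbounded, so the local steps are
arbitrary functions. (The message that a node addresses to itself carries nothing that the node
could not keep in its own state.) -/
structure CliqueAlgorithm (n b : ℕ) (In Out : Type) where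
  /-- The possible states of the local memory of a node. -/
  State : Type
  /-- The state in which node `v` starts on its local input. -/
  init : (v : Fin n) → In → State
  /-- `send v r s u` is the message that `v`, in state `s`, sends to `u` in round `r`. -/
  send : (v : Fin n) → (r : ℕ) → State → (u : Fin n) → (Fin b → Bool)
  /-- `receive v r s m` is the state of `v` after round `r`, if its state before the round was `s`
  and `m u` is the message that arrived from `u`. -/
  receive : (v : Fin n) → (r : ℕ) → State → (m : Fin n → (Fin b → Bool)) → State
  /-- The output of `v`, read off from its state. -/
  output : (v : Fin n) → State → Out

namespace CliqueAlgorithm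

variable {n b : ℕ} {In Out : Type}

/-- The states of all nodes after the given number of rounds, on the input `x`. -/
def stateAfter (alg : CliqueAlgorithm n b In Out) (x : Fin n → In) : ℕ → Fin n → alg.State
  | 0 => fun v => alg.init v (x v)
  | r + 1 => fun v =>
      alg.receive v r (alg.stateAfter x r v) (fun u => alg.send u r (alg.stateAfter x r u) v)

/-- The output of node `v` if the algorithm is stopped after `R` rounds on the input `x`. -/
def outputAfter (alg : CliqueAlgorithm n b In Out) (x : Fin n → In) (R : ℕ) (v : Fin n) : Out :=
  alg.output v (alg.stateAfter x R v)

end CliqueAlgorithm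

/-- The local input of a node: the subarray that it holds, and its list of range minimum queries,
each of which is a pair `(i, j)` of positions, counted from `1`, in the whole array. -/
structure RMQNodeInput where
  subarray : List ℤ
  queries : List (ℕ × ℕ)

/-- `x` is the minimum of the entries of `A` at the positions `i, i + 1, …, j`. Positions are
counted from `1`, so that the entry at position `k ≥ 1` is `A[k - 1]?`. -/
def IsRangeMin (A : List ℤ) (i j : ℕ) (x : ℤ) : Prop :=
  IsLeast {y : ℤ | ∃ k : ℕ, 1 ≤ k ∧ i ≤ k ∧ k ≤ j ∧ A[k - 1]? = some y} x

/-! Cut a range along the blocks `A_s`. A block strictly between the two blocks that contain the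
ends of the range contributes its whole minimum. Once every node has broadcast the length and the
minimum of its block, a query therefore leaves only two open items, each asking for the contribution
of one block that contains an end (`blocksRangeMin_congr`).

All items may concern the same block, so its owner cannot answer them alone. The items are ranked
block by block and cut into chunks of at most `n` items of one block; each chunk is given to a
virtual helper that obtains a copy of the block. There are only `O(n)` helpers, so each node plays
`O(1)` of them and handles `O(n)` items (`helper_lt`, `card_helper_mod_le`). Copying is cheap: each
block is scattered over all nodes, and every node passes on its `O(1)` entries of a block to each
helper in need of that block.

Items reach the helpers, and answers return, by `Held.route`: if every node sends and receives
`O(n)` items, then `O(1)` rounds suffice. With `m` about `√n`, the nodes form `m` residue classes,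
called groups. A group is small enough for its members to share all their item counts by class
(`Extends.share`), so they agree on an edge colouring that spreads the items of each class evenly
over all nodes (`Held.spread`). A greedy colouring with twice the natural number of colours is good
enough (`exists_balanced_coloring`).

No program is written down. The knowledge of a node is a relation between global inputs, and a
message is legitimate as soon as the knowledge of its sender determines it (`Extends.round`); this
suffices because local computation is free. -/

open Finset

/-! ### Knowledge of the nodes, and its growth by communication -/

/-- `Reach b inp R E` says that some algorithm with messages of `b` bits makes every node `v`,
within `R` rounds, distinguish any two global inputs that are not related by `E v`. -/
def Reach {n : ℕ} (b : ℕ) {X In : Type} (inp : X → Fin n → In) (R : ℕ)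
    (E : Fin n → X → X → Prop) : Prop :=
  ∃ alg : CliqueAlgorithm n b In Unit, ∀ v x x',
    alg.stateAfter (inp x) R v = alg.stateAfter (inp x') R v → E v x x'

/-- `Extends b k E E'` says that the knowledge `E'` refines `E` and can be obtained from it within
`k` further rounds with messages of `b` bits. -/
def Extends {n : ℕ} {X : Type} (b k : ℕ) (E E' : Fin n → X → X → Prop) : Prop :=
  (∀ v x x', E' v x x' → E v x x') ∧
    ∀ (In : Type) (inp : X → Fin n → In) (R : ℕ), Reach b inp R E → Reach b inp (R + k) E'

section Knowledge

variable {n b : ℕ} {X : Type} {E E' E'' : Fin n → X → X → Prop}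

theorem Extends.trans {k k' : ℕ} (h : Extends b k E E') (h' : Extends b k' E' E'') :
    Extends b (k + k') E E'' := by
  refine ⟨fun v x x' e => h.1 _ _ _ (h'.1 _ _ _ e), fun In inp R r => ?_⟩
  rw [← add_assoc]
  exact h'.2 _ _ _ (h.2 _ _ _ r)

theorem Reach.refine {In : Type} {inp : X → Fin n → In} {R : ℕ} (h : Reach b inp R E)
    (hE : ∀ v x x', E v x x' → E' v x x') : Reach b inp R E' := by
  obtain ⟨alg, h⟩ := h
  exact ⟨alg, fun v x x' e => hE _ _ _ (h _ _ _ e)⟩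

theorem Extends.refine {k : ℕ} (h : Extends b k E E')
    (hE : ∀ v x x', E' v x x' → E'' v x x') (hE' : ∀ v x x', E'' v x x' → E v x x') :
    Extends b k E E'' :=
  ⟨hE', fun In inp R r => (h.2 In inp R r).refine hE⟩

theorem Extends.refl : Extends b 0 E E := ⟨fun _ _ _ h => h, fun _ _ _ h => h⟩

open Classical in
/-- One round of communication. -/
theorem Extends.round (msg : X → Fin n → Fin n → Fin b → Bool)
    (hmsg : ∀ u x x', E u x x' → ∀ v, msg x u v = msg x' u v) :
    Extends b 1 E (fun v x x' => E v x x' ∧ ∀ u, msg x u v = msg x' u v) := by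
  refine ⟨fun v x x' e => e.1, fun In inp R => ?_⟩
  rintro ⟨alg, halg⟩
  let alg' : CliqueAlgorithm n b In Unit :=
    { State := alg.State × (Fin n → Fin b → Bool)
      init := fun v i => (alg.init v i, fun _ _ => false)
      send := fun v r s u =>
        if r < R then alg.send v r s.1 u
        -- The sender does not know the global input, so it takes any one that leads to its present
        -- state. By `hmsg` the choice does not affect the message.
        else if h : ∃ x, alg.stateAfter (inp x) R v = s.1 then msg h.choose v u
        else fun _ => false
      receive := fun v r s m => if r < R then (alg.receive v r s.1 m, s.2) else (s.1, m)
      output := fun _ _ => () }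
  have key : ∀ x r, r ≤ R → ∀ v, (alg'.stateAfter (inp x) r v).1 = alg.stateAfter (inp x) r v := by
    intro x r
    induction r with
    | zero => intro _ v; rfl
    | succ r ih =>
      intro hr v
      have hr' : r < R := hr
      simp only [CliqueAlgorithm.stateAfter]
      have h1 : ∀ v s m, alg'.receive v r s m = (alg.receive v r s.1 m, s.2) := by
        intro v s m; simp [alg', hr']
      have h2 : ∀ v s u, alg'.send v r s u = alg.send v r s.1 u := by
        intro v s m; simp [alg', hr']
      rw [h1]
      simp only [h2, ih hr'.le]
  have key2 : ∀ x v, alg'.stateAfter (inp x) (R + 1) v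
      = (alg.stateAfter (inp x) R v, fun u => msg x u v) := by
    intro x v
    have h1 : ∀ v s m, alg'.receive v R s m = (s.1, m) := by
      intro v s m; simp [alg']
    have h2 : ∀ u, alg'.send u R (alg'.stateAfter (inp x) R u) v = msg x u v := by
      intro u
      have hex : ∃ x', alg.stateAfter (inp x') R u = (alg'.stateAfter (inp x) R u).1 :=
        ⟨x, (key x R le_rfl u).symm⟩
      have : alg'.send u R (alg'.stateAfter (inp x) R u) v = msg hex.choose u v := by
        simp only [alg', lt_irrefl, if_false]
        exact dif_pos hex
      rw [this]
      refine hmsg u _ _ (halg u _ _ ?_) v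
      rw [hex.choose_spec, key x R le_rfl u]
    simp only [CliqueAlgorithm.stateAfter, h1, h2, key x R le_rfl]
  refine ⟨alg', fun v x x' e => ?_⟩
  rw [key2, key2, Prod.mk.injEq] at e
  exact ⟨halg v x x' e.1, fun u => congrFun e.2 u⟩

/-- All `k` messages are determined by `E`, hence also by the finer knowledge present in later
rounds, so single rounds can be chained. -/
theorem Extends.rounds (k : ℕ) (msg : X → Fin n → Fin n → ℕ → Fin b → Bool)
    (hmsg : ∀ u x x', E u x x' → ∀ v, msg x u v = msg x' u v) :
    Extends b k E (fun v x x' => E v x x' ∧ ∀ u, ∀ t < k, msg x u v t = msg x' u v t) := by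
  induction k with
  | zero => simpa using Extends.refl
  | succ k ih =>
    refine (ih.trans (Extends.round (fun x u v => msg x u v k) ?_)).refine ?_ ?_
    · intro u x x' e v
      rw [hmsg u x x' e.1 v]
    · rintro v x x' ⟨⟨e, h⟩, h'⟩
      refine ⟨e, fun u t ht => ?_⟩
      rcases Nat.lt_succ_iff_lt_or_eq.1 ht with ht | rfl
      · exact h u t ht
      · exact h' u
    · exact fun v x x' e => e.1

/-- Every node sends to every node a value from a set of at most `2 ^ (k * b)` values. -/
theorem Extends.exchange {T : Type} (k : ℕ) (msg : X → Fin n → Fin n → T) (W : Finset T)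
    (hW : ∀ x u v, msg x u v ∈ W) (hk : W.card ≤ 2 ^ (k * b))
    (hmsg : ∀ u x x', E u x x' → ∀ v, msg x u v = msg x' u v) :
    Extends b k E (fun v x x' => E v x x' ∧ ∀ u, msg x u v = msg x' u v) := by
  have hc : Fintype.card W ≤ Fintype.card (Fin k → Fin b → Bool) := by
    simpa [← pow_mul, mul_comm] using hk
  obtain ⟨f⟩ := Function.Embedding.nonempty_of_card_le hc
  refine (Extends.rounds k
    (fun x u v t => if h : t < k then f ⟨msg x u v, hW x u v⟩ ⟨t, h⟩ else fun _ => false)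
    ?_).refine ?_ ?_
  · intro u x x' e v
    have := hmsg u x x' e v
    funext t
    simp only [this]
  · rintro v x x' ⟨e, h⟩
    refine ⟨e, fun u => ?_⟩
    have : f ⟨msg x u v, hW x u v⟩ = f ⟨msg x' u v, hW x' u v⟩ := by
      funext t
      have := h u t t.2
      simpa using this
    simpa using f.injective this
  · exact fun v x x' e => e.1

/-- The holder `h x i` of each item `i` knows that it holds `i`, and knows `p x i`. -/
def Held {ι P : Type} (E : Fin n → X → X → Prop) (h : X → ι → Fin n) (p : X → ι → P) : Prop :=
  ∀ u x x', E u x x' → ∀ i, (h x i = u ↔ h x' i = u) ∧ (h x i = u → p x i = p x' i)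

theorem Held.map {ι P Q : Type} {h : X → ι → Fin n} {p : X → ι → P} (H : Held E h p)
    (f : P → Q) : Held E h (fun x i => f (p x i)) :=
  fun u x x' e i => ⟨(H u x x' e i).1, fun hi => congrArg f ((H u x x' e i).2 hi)⟩

/-- A node can compute every set of its own items that is selected by their payloads. Counts and
ranks in such sets may therefore steer its messages. -/
theorem Held.filter_eq {ι P : Type} [Fintype ι] {h : X → ι → Fin n} {p : X → ι → P}
    (H : Held E h p) {u : Fin n} {x x' : X} (e : E u x x') (q : ι → P → Prop)
    [∀ x, DecidablePred fun i => h x i = u ∧ q i (p x i)] :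
    (univ.filter fun i => h x i = u ∧ q i (p x i)) =
      univ.filter fun i => h x' i = u ∧ q i (p x' i) := by
  ext i
  have := H u x x' e i
  simp only [mem_filter, mem_univ, true_and]
  constructor
  · rintro ⟨a, c⟩
    exact ⟨this.1.1 a, this.2 a ▸ c⟩
  · rintro ⟨a, c⟩
    exact ⟨this.1.2 a, (this.2 (this.1.2 a)).symm ▸ c⟩

open Classical in
/-- The sets with at most `c` elements of a finite set are few. -/
theorem exists_finset_small_subsets {α : Type} (S : Finset α) (c : ℕ) :
    ∃ W : Finset (Finset α), W.card ≤ (S.card + 1) ^ c ∧ ∀ s ⊆ S, s.card ≤ c → s ∈ W := by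
  -- A small set is listed by a function on `Fin c`, with `none` as padding; this leaves `S.card +
  -- 1` values for each place.
  refine ⟨(Fintype.piFinset fun _ : Fin c => insertNone S).image
    (fun f => eraseNone (univ.image f)), ?_, ?_⟩
  · refine card_image_le.trans ?_
    simp
  · intro s hs hc
    refine mem_image.2 ⟨fun t => s.toList[(t : ℕ)]?, ?_, ?_⟩
    · rw [Fintype.mem_piFinset]
      intro t
      cases h : s.toList[(t : ℕ)]? with
      | none => simp
      | some y =>
        have := List.mem_of_getElem? h
        simpa using hs (by simpa using this)
    · ext y
      simp only [mem_eraseNone, mem_image, mem_univ, true_and]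
      constructor
      · rintro ⟨t, ht⟩
        simpa using List.mem_of_getElem? ht
      · intro hy
        have : y ∈ s.toList := by simpa using hy
        obtain ⟨t, ht, rfl⟩ := List.getElem_of_mem this
        have ht' : t < c := by
          have := s.length_toList
          omega
        exact ⟨⟨t, ht'⟩, by simp⟩

open Classical in
/-- The holders of the items pass them on, such that every node sends at most `c` items to every
other node. -/
theorem Held.hop {ι P : Type} [Fintype ι] {h h' : X → ι → Fin n} {p : X → ι → P} {c s k : ℕ}
    (W : Finset P) (hW : ∀ x i, p x i ∈ W) (hs : Fintype.card ι * W.card + 1 ≤ 2 ^ (s * b))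
    (hk : k = s * c)
    (H : Held E h (fun x i => (h' x i, p x i)))
    (hc : ∀ x u v, (univ.filter fun i => h x i = u ∧ h' x i = v).card ≤ c) :
    ∃ E', Extends b k E E' ∧ Held E' h' p := by
  obtain ⟨WW, hWW, hmem⟩ := exists_finset_small_subsets ((univ : Finset ι) ×ˢ W) c
  -- The names of the items travel with the payloads. The receiver thus learns exactly which items
  -- it now holds, including that it holds no others.
  let msg : X → Fin n → Fin n → Finset (ι × P) := fun x u v =>
    (univ.filter fun i => h x i = u ∧ h' x i = v).image fun i => (i, p x i)
  have hmsg : ∀ x u v i y, (i, y) ∈ msg x u v ↔ (h x i = u ∧ h' x i = v) ∧ p x i = y := by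
    intro x u v i y
    simp only [msg, mem_image, mem_filter, mem_univ, true_and, Prod.mk.injEq]
    constructor
    · rintro ⟨j, h1, rfl, h2⟩
      exact ⟨h1, h2⟩
    · rintro ⟨h1, h2⟩
      exact ⟨i, h1, rfl, h2⟩
  refine ⟨_, Extends.exchange k msg WW ?_ ?_ ?_, ?_⟩
  · intro x u v
    refine hmem _ ?_ (card_image_le.trans (hc x u v))
    intro y hy
    obtain ⟨i, y⟩ := y
    rw [hmsg] at hy
    simp [← hy.2, hW]
  · refine hWW.trans ?_
    rw [card_product, card_univ]
    refine (Nat.pow_le_pow_left hs c).trans ?_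
    rw [← pow_mul, hk]
    apply le_of_eq
    ring
  · intro u x x' e v
    ext ⟨i, y⟩
    rw [hmsg, hmsg]
    have := H u x x' e i
    simp only [Prod.mk.injEq] at this
    constructor
    · rintro ⟨⟨h1, h2⟩, h3⟩
      obtain ⟨h4, h5⟩ := this.2 h1
      exact ⟨⟨this.1.1 h1, h4 ▸ h2⟩, h5 ▸ h3⟩
    · rintro ⟨⟨h1, h2⟩, h3⟩
      obtain ⟨h4, h5⟩ := this.2 (this.1.2 h1)
      exact ⟨⟨this.1.2 h1, h4 ▸ h2⟩, h5 ▸ h3⟩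
  · rintro v x x' ⟨-, hm⟩ i
    constructor
    · constructor
      · intro hv
        have : (i, p x i) ∈ msg x' (h x i) v := by
          rw [← hm, hmsg]; exact ⟨⟨rfl, hv⟩, rfl⟩
        rw [hmsg] at this
        exact this.1.2
      · intro hv
        have : (i, p x' i) ∈ msg x (h x' i) v := by
          rw [hm, hmsg]; exact ⟨⟨rfl, hv⟩, rfl⟩
        rw [hmsg] at this
        exact this.1.2
    · intro hv
      have : (i, p x i) ∈ msg x' (h x i) v := by
        rw [← hm, hmsg]; exact ⟨⟨rfl, hv⟩, rfl⟩
      rw [hmsg] at this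
      exact this.2.symm

open Classical in
/-- An algorithm can output whatever its nodes know. -/
theorem Reach.exists_output {In Out : Type} [Nonempty Out] {inp : X → Fin n → In} {R : ℕ}
    (h : Reach b inp R E)
    (out : X → Fin n → Out) (hout : ∀ v x x', E v x x' → out x v = out x' v) :
    ∃ alg : CliqueAlgorithm n b In Out, ∀ x v, alg.outputAfter (inp x) R v = out x v := by
  obtain ⟨alg, halg⟩ := h
  let alg' : CliqueAlgorithm n b In Out :=
    { State := alg.State
      init := alg.init
      send := alg.send
      receive := alg.receive
      output := fun v s =>
        if h : ∃ x, alg.stateAfter (inp x) R v = s then out h.choose v else Classical.arbitrary _ }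
  have key : ∀ x r v, alg'.stateAfter (inp x) r v = alg.stateAfter (inp x) r v := by
    intro x r
    induction r with
    | zero => intro v; rfl
    | succ r ih =>
      intro v
      simp only [CliqueAlgorithm.stateAfter, ih]
      rfl
  refine ⟨alg', fun x v => ?_⟩
  have hex : ∃ x', alg.stateAfter (inp x') R v = alg.stateAfter (inp x) R v := ⟨x, rfl⟩
  have : alg'.outputAfter (inp x) R v = out hex.choose v := by
    rw [CliqueAlgorithm.outputAfter, key]
    exact dif_pos hex
  rw [this]
  exact hout v _ _ (halg v _ _ hex.choose_spec)

theorem Reach.input {In : Type} (inp : X → Fin n → In) :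
    Reach b inp 0 (fun v x x' => inp x v = inp x' v) :=
  ⟨{ State := In
     init := fun _ i => i
     send := fun _ _ _ _ _ => false
     receive := fun _ _ s _ => s
     output := fun _ _ => () }, fun _ _ _ h => h⟩

end Knowledge

/-! ### Ranks in finite sets, and colourings of bipartite multigraphs -/

/-- The number of elements of `S` that precede `i` in a fixed enumeration of `ι`. -/
noncomputable def enumRank {ι : Type} [Fintype ι] (S : Finset ι) (i : ι) : ℕ :=
  (S.filter fun j => Fintype.equivFin ι j < Fintype.equivFin ι i).card

theorem enumRank_lt {ι : Type} [Fintype ι] {S : Finset ι} {i : ι} (hi : i ∈ S) :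
    enumRank S i < S.card := by
  refine card_lt_card ((filter_ssubset).2 ⟨i, hi, lt_irrefl _⟩)

theorem enumRank_lt_enumRank {ι : Type} [Fintype ι] {S : Finset ι} {i j : ι} (hi : i ∈ S)
    (hij : Fintype.equivFin ι i < Fintype.equivFin ι j) : enumRank S i < enumRank S j := by
  refine card_lt_card ⟨fun k hk => ?_, fun hs => ?_⟩
  · rw [mem_filter] at hk ⊢
    exact ⟨hk.1, hk.2.trans hij⟩
  · have := hs (mem_filter.2 ⟨hi, hij⟩)
    rw [mem_filter] at this
    exact lt_irrefl _ this.2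

theorem enumRank_injOn {ι : Type} [Fintype ι] {S : Finset ι} {i j : ι} (hi : i ∈ S) (hj : j ∈ S)
    (h : enumRank S i = enumRank S j) : i = j := by
  rcases lt_trichotomy (Fintype.equivFin ι i) (Fintype.equivFin ι j) with hij | hij | hij
  · exact absurd h (enumRank_lt_enumRank hi hij).ne
  · exact (Fintype.equivFin ι).injective hij
  · exact absurd h (enumRank_lt_enumRank hj hij).ne'

/-- Numbers below `c * n` in a residue class modulo `n`: there are at most `c` of them. -/
theorem card_le_of_mod_eq {ι : Type} (S : Finset ι) (f : ι → ℕ) {c n k : ℕ}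
    (hf : ∀ i ∈ S, f i < c * n ∧ f i % n = k) (hinj : Set.InjOn f S) : S.card ≤ c := by
  have hle := card_le_card_of_injOn (s := S) (t := range c) (fun i => f i / n) ?_ ?_
  · simpa using hle
  · intro i hi
    have := (hf i hi).1
    rw [mem_coe, mem_range]
    exact Nat.div_lt_of_lt_mul (by rwa [mul_comm])
  · intro i hi j hj hij
    apply hinj hi hj
    have h1 := (hf i hi).2
    have h2 := (hf j hj).2
    have hij : f i / n = f j / n := hij
    rw [← Nat.div_add_mod (f i) n, ← Nat.div_add_mod (f j) n, h1, h2, hij]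

open Classical in
/-- Greedy colouring of a bipartite multigraph with edge set `S`: with `2 * N` colours, edges with
the same `f`-end get different colours, and each colour occurs at most `T z` times at the
`g`-end `z`. -/
theorem exists_balanced_coloring {α β γ : Type} (f : α → β) (g : α → γ) (N : ℕ) (T : γ → ℕ)
    (S : Finset α) (hf : ∀ y, (S.filter fun e => f e = y).card ≤ N)
    (hg : ∀ z, (S.filter fun e => g e = z).card ≤ N * T z) :
    ∃ col : α → ℕ, (∀ e ∈ S, col e < 2 * N) ∧
      (∀ e ∈ S, ∀ e' ∈ S, f e = f e' → col e = col e' → e = e') ∧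
      ∀ z k, (S.filter fun e => g e = z ∧ col e = k).card ≤ T z := by
  induction S using Finset.induction_on with
  | empty => exact ⟨fun _ => 0, by simp, by simp, by simp⟩
  | insert a S ha ih =>
    obtain ⟨col, h1, h2, h3⟩ := ih
      (fun y => (card_le_card (filter_subset_filter _ (subset_insert _ _))).trans (hf y))
      (fun z => (card_le_card (filter_subset_filter _ (subset_insert _ _))).trans (hg z))
    let A := (S.filter fun e => f e = f a).image col
    let B := (range (2 * N)).filter fun k =>
      T (g a) ≤ (S.filter fun e => g e = g a ∧ col e = k).card
    have hA : A.card < N := by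
      have := hf (f a)
      rw [filter_insert, if_pos rfl, card_insert_of_notMem (by simp [ha])] at this
      exact lt_of_le_of_lt card_image_le this
    -- Each colour in `B` already uses up `T (g a)` edges at the end `g a`, and fewer than `N * T (g
    -- a)` edges other than `a` meet it.
    have hB : B.card < N := by
      have hlt := hg (g a)
      rw [filter_insert, if_pos rfl, card_insert_of_notMem (by simp [ha])] at hlt
      have hsum : B.card * T (g a) ≤ (S.filter fun e => g e = g a).card := by
        calc B.card * T (g a) = ∑ k ∈ B, T (g a) := by simp
          _ ≤ ∑ k ∈ B, (S.filter fun e => g e = g a ∧ col e = k).card :=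
              sum_le_sum fun k hk => (mem_filter.1 hk).2
          _ = ∑ k ∈ B, ((S.filter fun e => g e = g a).filter fun e => col e = k).card := by
              simp only [filter_filter]
          _ ≤ (S.filter fun e => g e = g a).card := by
              rw [← card_biUnion]
              · exact card_le_card (biUnion_subset.2 fun k _ => filter_subset _ _)
              · intro k _ k' _ hkk
                refine disjoint_filter.2 fun e _ h h' => hkk (h ▸ h')
      by_contra hcon
      have := Nat.mul_le_mul_right (T (g a)) (not_lt.1 hcon)
      omega
    obtain ⟨k, hk, hkAB⟩ : ∃ k ∈ range (2 * N), k ∉ A ∪ B := by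
      refine exists_mem_notMem_of_card_lt_card ?_
      have := card_union_le A B
      rw [card_range]
      omega
    have hkA : ∀ e ∈ S, f e = f a → col e ≠ k := fun e he hfe hc =>
      hkAB (mem_union_left _ (mem_image.2 ⟨e, mem_filter.2 ⟨he, hfe⟩, hc⟩))
    have hkB : (S.filter fun e => g e = g a ∧ col e = k).card < T (g a) := by
      by_contra hcon
      exact hkAB (mem_union_right _ (mem_filter.2 ⟨hk, not_lt.1 hcon⟩))
    have hup : ∀ e ∈ S, Function.update col a k e = col e := fun e he =>
      Function.update_of_ne (fun h : e = a => ha (h ▸ he)) _ _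
    refine ⟨Function.update col a k, ?_, ?_, ?_⟩
    · intro e he
      rcases mem_insert.1 he with rfl | he
      · simpa using hk
      · rw [hup e he]; exact h1 e he
    · intro e he e' he' hff hcc
      rcases mem_insert.1 he with hea | heS <;> rcases mem_insert.1 he' with hea' | heS'
      · rw [hea, hea']
      · subst hea
        rw [hup e' heS', Function.update_self] at hcc
        exact absurd hcc.symm (hkA e' heS' hff.symm)
      · subst hea'
        rw [hup e heS, Function.update_self] at hcc
        exact absurd hcc (hkA e heS hff)
      · rw [hup e heS, hup e' heS'] at hcc
        exact h2 e heS e' heS' hff hcc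
    · intro z j
      have hS : (S.filter fun e => g e = z ∧ Function.update col a k e = j)
          = S.filter fun e => g e = z ∧ col e = j :=
        filter_congr fun e he => by rw [hup e he]
      rw [filter_insert, hS]
      split_ifs with hz
      · rw [Function.update_self] at hz
        obtain ⟨rfl, rfl⟩ := hz
        exact (card_insert_le _ _).trans hkB
      · exact h3 z j

open Classical in
/-- The colouring of the bipartite multigraph with multiplicities `M u z`. -/
theorem exists_matrix_coloring {n : ℕ} (B N : ℕ) (M : Fin n → ℕ → ℕ)
    (hrow : ∀ u, ∑ z ∈ range B, M u z ≤ N) :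
    ∃ col : Fin n → ℕ → ℕ → ℕ,
      (∀ u, ∀ z < B, ∀ j < M u z, col u z j < 2 * N) ∧
      (∀ u, ∀ z < B, ∀ j < M u z, ∀ z' < B, ∀ j' < M u z', col u z j = col u z' j' →
        z = z' ∧ j = j') ∧
      ∀ z < B, ∀ k, ∀ S : Finset (Fin n × ℕ), (∀ e ∈ S, e.2 < M e.1 z ∧ col e.1 z e.2 = k) →
        S.card ≤ (∑ u, M u z) / N + 1 := by
  let S : Finset ((_ : Fin n × ℕ) × ℕ) :=
    ((univ : Finset (Fin n)) ×ˢ range B).sigma fun uz => range (M uz.1 uz.2)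
  have hS : ∀ u z j, (⟨(u, z), j⟩ : (_ : Fin n × ℕ) × ℕ) ∈ S ↔ z < B ∧ j < M u z := by
    intro u z j
    simp [S]
  have hf : ∀ u, (S.filter fun e => e.1.1 = u).card ≤ N := by
    intro u
    have : (S.filter fun e => e.1.1 = u).card ≤ ((range B).sigma fun z => range (M u z)).card := by
      refine card_le_card_of_injOn (fun e => ⟨e.1.2, e.2⟩) ?_ ?_
      · rintro ⟨⟨v, z⟩, j⟩ he
        simp only [coe_filter, Set.mem_ofPred_eq, hS] at he
        obtain ⟨he, rfl⟩ := he
        simpa using he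
      · rintro ⟨⟨v, z⟩, j⟩ he ⟨⟨v', z'⟩, j'⟩ he' h
        simp only [coe_filter, Set.mem_ofPred_eq] at he he'
        simp at h
        simp [h, he.2, he'.2]
    refine this.trans ?_
    simpa using hrow u
  have hg : ∀ z, (S.filter fun e => e.1.2 = z).card ≤ N * ((∑ u, M u z) / N + 1) := by
    intro z
    have hle : (S.filter fun e => e.1.2 = z).card ≤
        ((univ : Finset (Fin n)).sigma fun u => range (M u z)).card := by
      refine card_le_card_of_injOn (fun e => ⟨e.1.1, e.2⟩) ?_ ?_
      · rintro ⟨⟨v, z⟩, j⟩ he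
        simp only [coe_filter, Set.mem_ofPred_eq, hS] at he
        obtain ⟨he, rfl⟩ := he
        simpa using he.2
      · rintro ⟨⟨v, z⟩, j⟩ he ⟨⟨v', z'⟩, j'⟩ he' h
        simp only [coe_filter, Set.mem_ofPred_eq] at he he'
        simp at h
        simp [h, he.2, he'.2]
    rw [card_sigma] at hle
    simp only [card_range] at hle
    -- For `N = 0` the division is void, but `hrow` leaves no edges at all.
    rcases Nat.eq_zero_or_pos N with rfl | hN
    · have hz : (S.filter fun e => e.1.2 = z) = ∅ := by
        rw [filter_eq_empty_iff]
        rintro ⟨⟨v, z⟩, j⟩ he -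
        rw [hS] at he
        have h0 := hrow v
        have := single_le_sum (f := fun z => M v z) (fun _ _ => Nat.zero_le _)
          (mem_range.2 he.1)
        omega
      simp [hz]
    · refine hle.trans ?_
      have := Nat.div_add_mod (∑ u, M u z) N
      have := Nat.mod_lt (∑ u, M u z) hN
      rw [mul_add, mul_one]
      omega
  obtain ⟨col, h1, h2, h3⟩ := exists_balanced_coloring (fun e : (_ : Fin n × ℕ) × ℕ => e.1.1)
    (fun e => e.1.2) N (fun z => (∑ u, M u z) / N + 1) S (fun y => by convert hf y)
    (fun z => by convert hg z)
  refine ⟨fun u z j => col ⟨(u, z), j⟩, ?_, ?_, ?_⟩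
  · intro u z hz j hj
    exact h1 _ ((hS _ _ _).2 ⟨hz, hj⟩)
  · intro u z hz j hj z' hz' j' hj' hcc
    have := h2 _ ((hS _ _ _).2 ⟨hz, hj⟩) _ ((hS _ _ _).2 ⟨hz', hj'⟩) rfl hcc
    simpa using this
  · intro z hz k Q hQ
    refine le_trans ?_ (h3 z k)
    refine card_le_card_of_injOn (fun e => ⟨(e.1, z), e.2⟩) ?_ ?_
    · intro e he
      have := hQ e he
      simp only [coe_filter, Set.mem_ofPred_eq]
      exact ⟨(hS _ _ _).2 ⟨hz, this.1⟩, by simp, this.2⟩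
    · rintro ⟨u, j⟩ _ ⟨u', j'⟩ _ h
      simpa using h

/-! ### Routing in a constant number of rounds -/

section Routing

variable {n b m : ℕ} {X : Type} {E : Fin n → X → X → Prop}

/-- The node with number `g + m * t`, where this makes sense. -/
def gridNode (m : ℕ) (hn : 0 < n) (g t : ℕ) : Fin n := ⟨(g + m * t) % n, Nat.mod_lt _ hn⟩

theorem gridNode_val (hn : 0 < n) (hmn : m * m ≤ n) {g t : ℕ} (hg : g < m) (ht : t < m) :
    (gridNode m hn g t : ℕ) = g + m * t := by
  have : m * t + m ≤ m * m := by
    calc m * t + m = m * (t + 1) := by ring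
      _ ≤ _ := Nat.mul_le_mul_left _ ht
  exact Nat.mod_eq_of_lt (by omega)

theorem gridNode_self (hn : 0 < n) (u : Fin n) : gridNode m hn (u % m) (u / m) = u := by
  apply Fin.ext
  simp only [gridNode, Nat.mod_add_div]
  exact Nat.mod_eq_of_lt u.2

/-- All nodes of a group, which is a residue class modulo `m`, learn about `4 * m` values
from each other. -/
theorem Extends.share (hn : 0 < n) (hm : 0 < m) (hmn : m * m ≤ n) (hnm : n ≤ 4 * m * m)
    {T : Type} (val : X → Fin n → ℕ → T) (W : Finset T) (hW : ∀ x u z, val x u z ∈ W) (k : ℕ)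
    (hk : W.card ≤ 2 ^ (k * b))
    (hval : ∀ u x x', E u x x' → ∀ z, val x u z = val x' u z) :
    Extends b (20 * k) E (fun v x x' => E v x x' ∧
      ∀ u : Fin n, (u : ℕ) % m = v % m → ∀ z < 4 * m, val x u z = val x' u z) := by
  -- Relay `r` collects from every node the values whose index is congruent to `r` modulo `m`; four
  -- such indices lie below `4 * m`.
  have h1 := Extends.exchange (b := b) (E := E) (k * 4)
    (fun x (u r : Fin n) (e : Fin 4) => val x u (r % m + e * m))
    (Fintype.piFinset fun _ => W) (fun x u v => by simp [Fintype.mem_piFinset, hW]) (by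
      rw [Fintype.card_piFinset, prod_const, card_univ, mul_right_comm, pow_mul]
      simpa using Nat.pow_le_pow_left hk _)
    (fun u x x' e v => by funext z; exact hval u x x' e _)
  have h3 := h1.trans (Extends.exchange (b := b) (k * 16)
    (fun x (r v : Fin n) (e : Fin 4 × Fin 4) =>
      val x (gridNode m hn (v % m) (r / m + e.1 * m)) (r % m + e.2 * m))
    (Fintype.piFinset fun _ => W) (fun x u v => by simp [Fintype.mem_piFinset, hW]) (by
      rw [Fintype.card_piFinset, prod_const, card_univ, mul_right_comm, pow_mul]
      simpa using Nat.pow_le_pow_left hk _)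
    (fun r x x' e v => by
      funext z
      exact congrFun (e.2 (gridNode m hn (v % m) (r / m + z.1 * m))) z.2))
  have hkk : k * 4 + k * 16 = 20 * k := by ring
  rw [hkk] at h3
  refine h3.refine ?_ fun v x x' e => e.1
  rintro v x x' ⟨⟨e, -⟩, h⟩
  refine ⟨e, fun u hu z hz => ?_⟩
  -- The value `z` of `u` travels through the relay with residue `z % m` and quotient `u / m % m`.
  -- Both quotients `u / m` and `z` are below `4 * m`, which explains the `4 * 4` values in the
  -- second exchange.
  have hr := gridNode_val hn hmn (Nat.mod_lt z hm) (Nat.mod_lt (u / m) hm)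
  have hr1 : (gridNode m hn (z % m) (u / m % m) : ℕ) % m = z % m := by
    rw [hr, Nat.add_mul_mod_self_left, Nat.mod_mod]
  have hr2 : (gridNode m hn (z % m) (u / m % m) : ℕ) / m = u / m % m := by
    rw [hr, Nat.add_mul_div_left _ _ hm, Nat.div_eq_of_lt (Nat.mod_lt z hm), zero_add]
  have e1 : (u : ℕ) / m / m < 4 :=
    Nat.div_lt_of_lt_mul (Nat.div_lt_of_lt_mul (by have := u.2; nlinarith))
  have e2 : z / m < 4 := Nat.div_lt_of_lt_mul (by omega)
  have := congrFun (h (gridNode m hn (z % m) (u / m % m))) (⟨_, e1⟩, ⟨_, e2⟩)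
  simp only [hr1, hr2, ← hu, Nat.mod_add_div', gridNode_self] at this
  exact this

open Classical in
/-- Within a group the items, which have classes, are spread evenly over all nodes. -/
theorem Held.spread (hn : 0 < n) (hm : 0 < m) (hmn : m * m ≤ n) (hnm : n ≤ 4 * m * m)
    {ι P : Type} [Fintype ι] {h : X → ι → Fin n} {p : X → ι → P} {cls : X → ι → ℕ} {c s : ℕ}
    (W : Finset P) (hW : ∀ x i, p x i ∈ W) (hs : Fintype.card ι * W.card + 1 ≤ 2 ^ (s * b))
    (hcs : c * n + 1 ≤ 2 ^ (s * b)) (hcls : ∀ x i, cls x i < 4 * m)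
    (hrow : ∀ x u, (univ.filter fun i => h x i = u).card ≤ c * n)
    (H : Held E h (fun x i => (cls x i, p x i))) :
    ∃ E' h', Extends b (20 * s + s * (2 * c)) E E' ∧ Held E' h' p ∧
      ∀ x U z k, (univ.filter fun i => (h x i % m = U ∧ cls x i = z) ∧ h' x i = k).card ≤
        2 * c * ((univ.filter fun i => h x i % m = U ∧ cls x i = z).card / (c * n) + 1) := by
  let F : X → Fin n → ℕ → Finset ι := fun x u z => univ.filter fun i => h x i = u ∧ cls x i = z
  let d : X → Fin n → ℕ → ℕ := fun x u z => (F x u z).card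
  have hF : ∀ u x x', E u x x' → ∀ z, F x u z = F x' u z := fun u x x' e z =>
    H.filter_eq e fun _ y => y.1 = z
  have hdrow : ∀ x u, ∑ z ∈ range (4 * m), d x u z ≤ c * n := by
    intro x u
    refine le_trans (le_of_eq ?_) (hrow x u)
    rw [card_eq_sum_card_fiberwise (f := cls x) (t := range (4 * m))]
    · simp only [d, F, filter_filter]
    · intro i _
      simpa using hcls x i
  have hshare := Extends.share (E := E) hn hm hmn hnm d (range (c * n + 1))
    (fun x u z => by
      rw [mem_range, Nat.lt_succ_iff]
      refine le_trans (card_le_card ?_) (hrow x u)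
      exact fun i hi => by
        simp only [F, mem_filter] at hi ⊢
        exact ⟨hi.1, hi.2.1⟩) s (by simpa using hcs)
    (fun u x x' e z => by simp only [d, hF u x x' e z])
  -- The count matrix of a group is zero outside the group, so that it consists of shared knowledge
  -- only.
  let M : X → ℕ → Fin n → ℕ → ℕ := fun x g u z => if (u : ℕ) % m = g ∧ z < 4 * m then d x u z else 0
  have hMrow : ∀ x g u, ∑ z ∈ range (4 * m), M x g u z ≤ c * n := fun x g u =>
    (sum_le_sum fun z _ => by dsimp only [M]; split_ifs <;> simp).trans (hdrow x u)
  -- The colouring is a function of the matrix alone: nodes that know the same matrix choose the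
  -- same colouring.
  let colE : (Fin n → ℕ → ℕ) → Fin n → ℕ → ℕ → ℕ := fun Q =>
    if hQ : ∀ u, ∑ z ∈ range (4 * m), Q u z ≤ c * n then
      (exists_matrix_coloring (4 * m) (c * n) Q hQ).choose else fun _ _ _ => 0
  have hcolE : ∀ x g, _ := fun x g =>
    (exists_matrix_coloring (4 * m) (c * n) (M x g) (hMrow x g)).choose_spec
  have hcolE' : ∀ x g, (exists_matrix_coloring (4 * m) (c * n) (M x g) (hMrow x g)).choose
      = colE (M x g) := fun x g => by
    simp only [colE]
    rw [dif_pos (hMrow x g)]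
  simp only [hcolE'] at hcolE
  let rk : X → ι → ℕ := fun x i => enumRank (F x (h x i) (cls x i)) i
  have hmemF : ∀ x i, i ∈ F x (h x i) (cls x i) := fun x i => by simp [F]
  let color : X → ι → ℕ := fun x i => colE (M x (h x i % m)) (h x i) (cls x i) (rk x i)
  have hMd : ∀ x i, M x (h x i % m) (h x i) (cls x i) = d x (h x i) (cls x i) := fun x i =>
    if_pos ⟨rfl, hcls x i⟩
  have hrk : ∀ x i, rk x i < M x (h x i % m) (h x i) (cls x i) := fun x i => by
    rw [hMd]; exact enumRank_lt (hmemF x i)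
  have hcolor : ∀ x i, color x i < 2 * c * n := fun x i => by
    rw [mul_assoc]
    exact (hcolE x _).1 _ _ (hcls x i) _ (hrk x i)
  have hinj : ∀ x i j, h x i = h x j → cls x i = cls x j → rk x i = rk x j → i = j := by
    intro x i j h1 h2 h3
    refine enumRank_injOn (hmemF x i) (by rw [h1, h2]; exact hmemF x j) ?_
    simp only [rk] at h3
    rw [h3, h1, h2]
  -- Colours are read modulo `n` as the next holder. Each node stands for at most `2 * c` colours,
  -- and a holder uses each colour at most once.
  let h' : X → ι → Fin n := fun x i => ⟨color x i % n, Nat.mod_lt _ hn⟩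
  have Hhop : Held (fun v x x' => E v x x' ∧
      ∀ u : Fin n, (u : ℕ) % m = v % m → ∀ z < 4 * m, d x u z = d x' u z) h
      (fun x i => (h' x i, p x i)) := by
    rintro u x x' ⟨e, hd⟩ i
    have Hi := H u x x' e i
    refine ⟨Hi.1, fun hu => ?_⟩
    have hcp := Hi.2 hu
    simp only [Prod.mk.injEq] at hcp
    have hu' := Hi.1.1 hu
    have hMM : M x (u % m) = M x' (u % m) := by
      funext v z
      simp only [M]
      split_ifs with hvz
      · exact hd v hvz.1 z hvz.2
      · rfl
    have hcol : color x i = color x' i := by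
      simp only [color, rk, hu, hu', hcp.1, hMM, hF u x x' e]
    simp only [h', hcol, hcp.2]
  obtain ⟨E', hE', HE'⟩ := Hhop.hop (b := b) (c := 2 * c) (s := s) W hW hs rfl (by
    intro x u v
    refine card_le_of_mod_eq (n := n) (k := v) _ (color x) ?_ ?_
    · intro i hi
      simp only [mem_filter, mem_univ, true_and] at hi
      exact ⟨hcolor x i, by rw [← hi.2]⟩
    · intro i hi j hj hij
      simp only [coe_filter, mem_univ, true_and, Set.mem_ofPred_eq] at hi hj
      have hhij : h x i = h x j := hi.1.trans hj.1.symm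
      have := (hcolE x (h x i % m)).2.1 (h x i) _ (hcls x i) _ (hrk x i) (cls x j) (hcls x j)
        (rk x j) (by have := hrk x j; rwa [← hhij] at this) (by
          have hij : color x i = color x j := hij
          simp only [color] at hij
          rw [hij, hhij])
      exact hinj x i j hhij this.1 this.2)
  refine ⟨E', h', hshare.trans hE', HE', ?_⟩
  intro x U z k
  have hDle : ∑ u, M x U u z ≤ (univ.filter fun i => h x i % m = U ∧ cls x i = z).card := by
    rw [card_eq_sum_card_fiberwise (f := h x) (t := univ) (fun _ _ => mem_coe.2 (mem_univ _))]
    refine sum_le_sum fun u _ => ?_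
    simp only [M]
    split_ifs with hu
    · refine card_le_card fun i hi => ?_
      simp only [F, mem_filter, mem_univ, true_and] at hi ⊢
      exact ⟨⟨by rw [hi.1]; exact hu.1, hi.2⟩, hi.1⟩
    · exact Nat.zero_le _
  set S := univ.filter fun i => (h x i % m = U ∧ cls x i = z) ∧ h' x i = k with hS
  have hmemS : ∀ i ∈ S, h x i % m = U ∧ cls x i = z ∧ color x i % n = k := by
    intro i hi
    simp only [hS, mem_filter, mem_univ, true_and] at hi
    exact ⟨hi.1.1, hi.1.2, by rw [← hi.2]⟩
  have hcard := card_eq_sum_card_fiberwise (f := color x) (s := S)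
    (t := S.image (color x)) (fun i hi => mem_coe.2 (mem_image_of_mem _ hi))
  have hq : (S.image (color x)).card ≤ 2 * c := by
    refine card_le_of_mod_eq (n := n) (k := k) _ id ?_ Function.injective_id.injOn
    intro y hy
    obtain ⟨i, hi, rfl⟩ := mem_image.1 hy
    exact ⟨hcolor x i, (hmemS i hi).2.2⟩
  rw [hcard]
  refine (sum_le_card_nsmul _ _
    ((univ.filter fun i => h x i % m = U ∧ cls x i = z).card / (c * n) + 1) ?_).trans ?_
  · intro y hy
    obtain ⟨i₀, hi₀, -⟩ := mem_image.1 hy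
    have hz : z < 4 * m := by rw [← (hmemS i₀ hi₀).2.1]; exact hcls x i₀
    have := (hcolE x U).2.2 z hz y ((S.filter fun i => color x i = y).image
      fun i => (h x i, rk x i)) ?_
    · rw [card_image_of_injOn] at this
      · exact this.trans (Nat.succ_le_succ (Nat.div_le_div_right hDle))
      · intro i hi j hj hij
        rw [mem_coe, mem_filter] at hi hj
        simp only [Prod.mk.injEq] at hij
        exact hinj x i j hij.1 ((hmemS i hi.1).2.1.trans (hmemS j hj.1).2.1.symm) hij.2
    · intro e he
      obtain ⟨i, hi, rfl⟩ := mem_image.1 he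
      rw [mem_filter] at hi
      obtain ⟨h1, h2, -⟩ := hmemS i hi.1
      have h4 := hrk x i
      rw [h1, h2] at h4
      refine ⟨h4, ?_⟩
      rw [← hi.2]
      simp only [color, h1, h2]
  · rw [smul_eq_mul]
    exact Nat.mul_le_mul_right _ hq

open Classical in
/-- **Routing.** If every node holds at most `c * n` items, and is the destination of at most
`c * n` items, then all items can be delivered in a constant number of rounds. -/
theorem Held.route {ι P : Type} [Fintype ι] {h dest : X → ι → Fin n} {p : X → ι → P} {c s : ℕ}
    (hn : 0 < n) (hc : 0 < c)
    (W : Finset P) (hW : ∀ x i, p x i ∈ W)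
    (hs : Fintype.card ι * (n * W.card) + 1 ≤ 2 ^ (s * b))
    (hcs : 10 * c * n + 1 ≤ 2 ^ (s * b))
    (hrow : ∀ x u, (univ.filter fun i => h x i = u).card ≤ c * n)
    (hcol : ∀ x u, (univ.filter fun i => dest x i = u).card ≤ c * n)
    (H : Held E h (fun x i => (dest x i, p x i))) :
    ∃ E', Extends b (40 * s + 72 * (c * s)) E E' ∧ Held E' dest p := by
  obtain ⟨m, hm, hmn, hnm⟩ : ∃ m, 0 < m ∧ m * m ≤ n ∧ n ≤ 4 * m * m := by
    have hpos : 0 < Nat.sqrt n := Nat.sqrt_pos.2 hn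
    refine ⟨Nat.sqrt n, hpos, Nat.sqrt_le n, ?_⟩
    have := Nat.lt_succ_sqrt n
    rw [Nat.succ_eq_add_one] at this
    nlinarith
  have hidx : ∀ u : Fin n, (u : ℕ) / m < 4 * m := fun u =>
    Nat.div_lt_of_lt_mul (by have := u.2; nlinarith)
  let WD : Finset (Fin n × P) := (univ : Finset (Fin n)) ×ˢ W
  have hWD : WD.card = n * W.card := by simp [WD]
  obtain ⟨E₁, h₁, hE₁, H₁, hb₁⟩ := Held.spread (b := b) (c := c) (s := s) hn hm hmn hnm
    (E := E) (h := h) (p := fun x i => (dest x i, p x i)) (cls := fun x i => (dest x i : ℕ) % m)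
    WD (fun x i => by simp [WD, hW]) (by rwa [hWD]) (by nlinarith)
    (fun x i => (Nat.mod_lt _ hm).trans_le (by omega)) hrow
    (H.map fun y => ((y.1 : ℕ) % m, y))
  have hgroup : ∀ g, (univ.filter fun u : Fin n => (u : ℕ) % m = g).card ≤ 4 * m := fun g =>
    card_le_of_mod_eq (n := m) (k := g) _ (fun u : Fin n => (u : ℕ))
      (fun u hu => ⟨by have := u.2; omega, (mem_filter.1 hu).2⟩) Fin.val_injective.injOn
  have hD : ∀ x g, (univ.filter fun i => (dest x i : ℕ) % m = g).card ≤ c * n * (4 * m) := by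
    intro x g
    rw [card_eq_sum_card_fiberwise (f := dest x)
      (t := univ.filter fun u : Fin n => (u : ℕ) % m = g) (fun i hi => by simpa using hi)]
    refine (sum_le_card_nsmul _ _ (c * n) fun u _ => ?_).trans ?_
    · exact (card_le_card (by
        intro i hi
        simp only [mem_filter, mem_univ, true_and] at hi ⊢
        exact hi.2)).trans (hcol x u)
    · rw [smul_eq_mul, mul_comm]
      exact Nat.mul_le_mul_left _ (hgroup g)
  -- At most `4 * c * m * n` items are bound for the group `g`. Their quotients by `c * n` sum to at
  -- most `4 * m` over the `m` source groups, and the roundings add `m`; hence `2 * c * (5 * m)`.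
  have hX : ∀ x k g, (univ.filter fun i => h₁ x i = k ∧ (dest x i : ℕ) % m = g).card
      ≤ 10 * c * m := by
    intro x k g
    rw [card_eq_sum_card_fiberwise (f := fun i => (h x i : ℕ) % m) (t := range m)
      (fun i _ => by simpa using Nat.mod_lt _ hm)]
    have hsum : ∑ U ∈ range m,
        (univ.filter fun i => (h x i : ℕ) % m = U ∧ (dest x i : ℕ) % m = g).card
        ≤ c * n * (4 * m) := by
      refine le_trans (le_of_eq ?_) (hD x g)
      rw [card_eq_sum_card_fiberwise (f := fun i => (h x i : ℕ) % m) (t := range m)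
        (fun i _ => by simpa using Nat.mod_lt _ hm)]
      simp only [filter_filter, and_comm]
    calc _ ≤ ∑ U ∈ range m, 2 * c * ((univ.filter fun i =>
          (h x i : ℕ) % m = U ∧ (dest x i : ℕ) % m = g).card / (c * n) + 1) := by
          refine sum_le_sum fun U _ => le_trans (card_le_card ?_) (hb₁ x U g k)
          intro i hi
          simp only [mem_filter, mem_univ, true_and] at hi ⊢
          exact ⟨⟨hi.2, hi.1.2⟩, hi.1.1⟩
      _ = 2 * c * (∑ U ∈ range m, ((univ.filter fun i =>
          (h x i : ℕ) % m = U ∧ (dest x i : ℕ) % m = g).card / (c * n)) + m) := by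
          rw [← mul_sum, sum_add_distrib]; simp
      _ ≤ 2 * c * (4 * m + m) := by
          refine Nat.mul_le_mul_left _ (Nat.add_le_add_right ?_ _)
          have hcn : 0 < c * n := Nat.mul_pos hc hn
          refine Nat.le_of_mul_le_mul_left (le_trans ?_ hsum) hcn
          rw [mul_sum]
          exact sum_le_sum fun U _ => Nat.mul_div_le _ _
      _ = 10 * c * m := by ring
  let G : X → Fin n → ℕ → Finset ι := fun x u g =>
    univ.filter fun i => h₁ x i = u ∧ (dest x i : ℕ) % m = g
  let rk : X → ι → ℕ := fun x i => enumRank (G x (h₁ x i) (dest x i % m)) i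
  have hmemG : ∀ x i, i ∈ G x (h₁ x i) (dest x i % m) := fun x i => by simp [G]
  have hrk : ∀ x i, rk x i < 10 * c * m := fun x i => (enumRank_lt (hmemG x i)).trans_le (hX _ _ _)
  -- Each node deals its items for one destination group cyclically to `m` members of that group, so
  -- each of these gets at most `10 * c` of them.
  let h₂ : X → ι → Fin n := fun x i => gridNode m hn (dest x i % m) (rk x i % m)
  have hval₂ : ∀ x i, (h₂ x i : ℕ) = (dest x i : ℕ) % m + m * (rk x i % m) := fun x i =>
    gridNode_val hn hmn (Nat.mod_lt _ hm) (Nat.mod_lt _ hm)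
  have hmod₂ : ∀ x i, (h₂ x i : ℕ) % m = (dest x i : ℕ) % m := fun x i => by
    rw [hval₂, Nat.add_mul_mod_self_left, Nat.mod_mod]
  have hdiv₂ : ∀ x i, (h₂ x i : ℕ) / m = rk x i % m := fun x i => by
    rw [hval₂, Nat.add_mul_div_left _ _ hm, Nat.div_eq_of_lt (Nat.mod_lt _ hm), zero_add]
  have hc₂ : ∀ x u v, (univ.filter fun i => h₁ x i = u ∧ h₂ x i = v).card ≤ 10 * c := by
    intro x u v
    refine card_le_of_mod_eq (n := m) (k := v / m) _ (rk x) ?_ ?_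
    · intro i hi
      simp only [mem_filter, mem_univ, true_and] at hi
      exact ⟨hrk x i, by rw [← hdiv₂, hi.2]⟩
    · intro i hi j hj hij
      simp only [coe_filter, mem_univ, true_and, Set.mem_ofPred_eq] at hi hj
      have h1 : h₁ x i = h₁ x j := hi.1.trans hj.1.symm
      have h2 : (dest x i : ℕ) % m = dest x j % m := by rw [← hmod₂, ← hmod₂, hi.2, hj.2]
      refine enumRank_injOn (hmemG x i) (by rw [h1, h2]; exact hmemG x j) ?_
      simp only [rk] at hij
      rw [hij, h1, h2]
  have H₁' : Held E₁ h₁ (fun x i => (h₂ x i, (dest x i, p x i))) := by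
    intro u x x' e i
    have Hi := H₁ u x x' e i
    refine ⟨Hi.1, fun hu => ?_⟩
    have hcp := Hi.2 hu
    have hu' := Hi.1.1 hu
    have hG : ∀ g, G x u g = G x' u g := fun g => H₁.filter_eq e fun _ y => (y.1 : ℕ) % m = g
    simp only [Prod.mk.injEq] at hcp
    have : h₂ x i = h₂ x' i := by
      simp only [h₂, rk, hu, hu', hcp.1, hG]
    simp only [this, hcp.1, hcp.2]
  obtain ⟨E₂, hE₂, H₂⟩ := H₁'.hop (b := b) (c := 10 * c) (s := s) WD
    (fun x i => by simp [WD, hW]) (by rwa [hWD]) rfl hc₂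
  have hrow₂ : ∀ x u, (univ.filter fun i => h₂ x i = u).card ≤ 10 * c * n := by
    intro x u
    rw [card_eq_sum_card_fiberwise (f := h₁ x) (t := univ) (fun _ _ => mem_coe.2 (mem_univ _))]
    refine (sum_le_card_nsmul _ _ (10 * c) fun k _ => ?_).trans (by simp [mul_comm])
    refine le_trans (card_le_card ?_) (hc₂ x k u)
    intro i hi
    simp only [mem_filter, mem_univ, true_and] at hi ⊢
    exact ⟨hi.2, hi.1⟩
  obtain ⟨E₃, h₃, hE₃, H₃, hb₃⟩ := Held.spread (b := b) (c := 10 * c) (s := s) hn hm hmn hnm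
    (E := E₂) (h := h₂) (p := fun x i => (dest x i, p x i)) (cls := fun x i => (dest x i : ℕ) / m)
    WD (fun x i => by simp [WD, hW]) (by rwa [hWD]) hcs
    (fun x i => hidx _) hrow₂
    (H₂.map fun y => ((y.1 : ℕ) / m, y))
  obtain ⟨E₄, hE₄, H₄⟩ := H₃.hop (b := b) (c := 40 * c) (s := s) W hW
    ((Nat.succ_le_succ (Nat.mul_le_mul_left _ (Nat.le_mul_of_pos_left _ hn))).trans hs) rfl (by
      intro x u v
      refine le_trans (card_le_card ?_) ((hb₃ x (v % m) (v / m) u).trans ?_)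
      · intro i hi
        simp only [mem_filter, mem_univ, true_and] at hi ⊢
        exact ⟨⟨by rw [hmod₂, hi.2], by rw [hi.2]⟩, hi.1⟩
      -- Inside the group of `v`, the class `v / m` consists of the single destination `v`. It has
      -- at most `c * n` items, so the rounded quotient is at most `1 + 1`.
      · have hle : (univ.filter fun i => (h₂ x i : ℕ) % m = v % m ∧ (dest x i : ℕ) / m = v / m).card
            ≤ c * n := by
          refine le_trans (card_le_card ?_) (hcol x v)
          intro i hi
          simp only [mem_filter, mem_univ, true_and] at hi ⊢
          apply Fin.ext
          rw [← Nat.mod_add_div (dest x i) m, ← Nat.mod_add_div v m, ← hmod₂, hi.1, hi.2]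
        have : (univ.filter fun i =>
            (h₂ x i : ℕ) % m = v % m ∧ (dest x i : ℕ) / m = v / m).card / (10 * c * n) ≤ 1 := by
          refine Nat.div_le_of_le_mul (hle.trans ?_)
          nlinarith
        calc _ ≤ 2 * (10 * c) * (1 + 1) := Nat.mul_le_mul_left _ (Nat.succ_le_succ this)
          _ = 40 * c := by ring)
  refine ⟨E₄, ?_, H₄⟩
  have := ((hE₁.trans hE₂).trans hE₃).trans hE₄
  convert this using 1
  ring

end Routing

/-! ### Prefix sums and positions in a concatenation -/

section PrefixSum

variable {n : ℕ}

/-- The sum of the values of `f` at the arguments below `v`. -/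
def prefixSum (f : Fin n → ℕ) (v : Fin n) : ℕ := ∑ u, if u < v then f u else 0

theorem prefixSum_zero (f : Fin (n + 1) → ℕ) : prefixSum f 0 = 0 := by
  simp [prefixSum]

theorem prefixSum_succ (f : Fin (n + 1) → ℕ) (v : Fin n) :
    prefixSum f v.succ = f 0 + prefixSum (fun u => f u.succ) v := by
  simp [prefixSum, Fin.sum_univ_succ]

theorem prefixSum_add (f : Fin n → ℕ) (v : Fin n) :
    prefixSum f v + f v = ∑ u, if u ≤ v then f u else 0 := by
  have : f v = ∑ u, if u = v then f u else 0 := by simp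
  rw [prefixSum, this, ← sum_add_distrib]
  refine sum_congr rfl fun u _ => ?_
  rcases lt_trichotomy u v with h | h | h
  · simp [h, h.ne, h.le]
  · simp [h]
  · simp [h.not_gt, h.ne', h.not_ge]

theorem prefixSum_add_le_of_lt (f : Fin n → ℕ) {v v' : Fin n} (h : v < v') :
    prefixSum f v + f v ≤ prefixSum f v' := by
  rw [prefixSum_add, prefixSum]
  refine sum_le_sum fun u _ => ?_
  by_cases hu : u ≤ v
  · simp [hu, hu.trans_lt h]
  · simp [hu]

theorem prefixSum_add_le (f : Fin n → ℕ) (v : Fin n) : prefixSum f v + f v ≤ ∑ u, f u := by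
  rw [prefixSum_add]
  refine sum_le_sum fun u _ => ?_
  split_ifs <;> simp

theorem exists_prefixSum_le_lt (f : Fin n → ℕ) {k : ℕ} (hk : k < ∑ u, f u) :
    ∃ v, prefixSum f v ≤ k ∧ k < prefixSum f v + f v := by
  induction n generalizing k with
  | zero => simp at hk
  | succ n ih =>
    rw [Fin.sum_univ_succ] at hk
    by_cases h0 : k < f 0
    · exact ⟨0, by simp [prefixSum_zero], by simpa [prefixSum_zero] using h0⟩
    · obtain ⟨v, hv1, hv2⟩ := ih (fun u => f u.succ) (k := k - f 0) (by omega)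
      exact ⟨v.succ, by rw [prefixSum_succ]; omega, by rw [prefixSum_succ]; omega⟩

theorem getElem?_flatten_ofFn {α : Type} (f : Fin n → List α) (s : Fin n) {l : ℕ}
    (hl : l < (f s).length) :
    (List.ofFn f).flatten[prefixSum (fun v => (f v).length) s + l]? = (f s)[l]? := by
  induction n with
  | zero => exact s.elim0
  | succ n ih =>
    rw [List.ofFn_succ, List.flatten_cons]
    induction s using Fin.cases with
    | zero => rw [prefixSum_zero, zero_add, List.getElem?_append_left hl]
    | succ s =>
      rw [prefixSum_succ, List.getElem?_append_right (by omega), ← ih (fun v => f v.succ) s hl]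
      congr 1
      omega

end PrefixSum

/-! ### Range minima in terms of block minima -/

section BlockMinima

variable {n : ℕ}

/-- The entry at position `l`, counted from `0`, of the block `s`, and `⊤` if there is none. -/
def blockEntry (f : Fin n → List ℤ) (s : Fin n) (l : ℕ) : WithTop ℤ :=
  (f s)[l]?.elim ⊤ fun y => (y : WithTop ℤ)

/-- The lengths of the blocks. -/
def blockLength (f : Fin n → List ℤ) (s : Fin n) : ℕ := (f s).length

/-- The minimum of the entries of the block `s` whose positions, counted from `1` in the
concatenation of all blocks, are between `i` and `j`. -/
def blockRangeMin (f : Fin n → List ℤ) (s : Fin n) (i j : ℕ) : WithTop ℤ :=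
  ((range (blockLength f s)).filter fun l => i ≤ prefixSum (blockLength f) s + l + 1 ∧
    prefixSum (blockLength f) s + l + 1 ≤ j).inf (blockEntry f s)

/-- The minimum of the block `s`. -/
def blockMin (f : Fin n → List ℤ) (s : Fin n) : WithTop ℤ :=
  (range (blockLength f s)).inf (blockEntry f s)

/-- The minimum of the entries at positions from `i` to `j` in the concatenation of the blocks. -/
def blocksRangeMin (f : Fin n → List ℤ) (i j : ℕ) : WithTop ℤ :=
  univ.inf fun s => blockRangeMin f s i j

theorem length_flatten_ofFn (f : Fin n → List ℤ) :
    (List.ofFn f).flatten.length = ∑ s, blockLength f s := by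
  rw [List.length_flatten, List.map_ofFn, List.sum_ofFn]
  rfl

theorem isRangeMin_blocksRangeMin (f : Fin n → List ℤ) {i j : ℕ} (hi : 1 ≤ i) (hij : i ≤ j)
    (hj : j ≤ (List.ofFn f).flatten.length) :
    IsRangeMin (List.ofFn f).flatten i j ((blocksRangeMin f i j).untopD 0) := by
  have lower : ∀ k y, 1 ≤ k → i ≤ k → k ≤ j → (List.ofFn f).flatten[k - 1]? = some y →
      blocksRangeMin f i j ≤ (y : WithTop ℤ) := by
    intro k y h1 hik hkj hy
    have hk : k - 1 < ∑ s, blockLength f s := by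
      rw [← length_flatten_ofFn]; omega
    obtain ⟨s, hs1, hs2⟩ := exists_prefixSum_le_lt _ hk
    have hl : k - 1 - prefixSum (blockLength f) s < (f s).length := by
      have : blockLength f s = (f s).length := rfl
      omega
    have hget := getElem?_flatten_ofFn f s hl
    rw [show (fun v => (f v).length) = blockLength f from rfl, Nat.add_sub_cancel' hs1, hy] at hget
    have hentry : blockEntry f s (k - 1 - prefixSum (blockLength f) s) = (y : WithTop ℤ) := by
      rw [blockEntry, ← hget]; rfl
    rw [← hentry]
    refine (inf_le (mem_univ s)).trans (inf_le ?_)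
    rw [mem_filter, mem_range]
    exact ⟨hl, by omega, by omega⟩
  obtain ⟨y₀, hy₀⟩ : ∃ y, (List.ofFn f).flatten[i - 1]? = some y :=
    ⟨_, List.getElem?_eq_getElem (by omega)⟩
  -- The entry at position `i` makes the infimum finite, so the default `0` of `untopD` is never
  -- taken.
  have hne : blocksRangeMin f i j ≠ ⊤ := by
    have := lower i y₀ hi le_rfl hij hy₀
    intro h
    rw [h, top_le_iff] at this
    exact WithTop.coe_ne_top this
  obtain ⟨z, hz⟩ := WithTop.ne_top_iff_exists.1 hne
  rw [← hz, WithTop.untopD_coe]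
  refine ⟨?_, ?_⟩
  · have huniv : (univ : Finset (Fin n)).Nonempty := by
      rw [nonempty_iff_ne_empty]
      intro h
      exact hne (by rw [blocksRangeMin, h, inf_empty])
    obtain ⟨s, -, hs⟩ := exists_mem_eq_inf _ huniv fun s => blockRangeMin f s i j
    have hs' : (z : WithTop ℤ) = blockRangeMin f s i j := by rw [hz]; exact hs
    have hnon : ((range (blockLength f s)).filter fun l =>
        i ≤ prefixSum (blockLength f) s + l + 1 ∧
        prefixSum (blockLength f) s + l + 1 ≤ j).Nonempty := by
      rw [nonempty_iff_ne_empty]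
      intro h
      rw [blockRangeMin, h, inf_empty] at hs'
      exact WithTop.coe_ne_top hs'
    obtain ⟨l, hl, hlz⟩ := exists_mem_eq_inf _ hnon (blockEntry f s)
    rw [blockRangeMin, hlz] at hs'
    rw [mem_filter, mem_range] at hl
    refine ⟨prefixSum (blockLength f) s + l + 1, by omega, hl.2.1, hl.2.2, ?_⟩
    rw [Nat.add_sub_cancel]
    refine (getElem?_flatten_ofFn f s hl.1).trans ?_
    rw [blockEntry] at hs'
    cases h : (f s)[l]? with
    | none =>
      rw [h] at hs'
      exact absurd hs' WithTop.coe_ne_top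
    | some y =>
      rw [h] at hs'
      exact congrArg some (WithTop.coe_injective hs').symm
  · rintro y ⟨k, h1, hik, hkj, hy⟩
    have := lower k y h1 hik hkj hy
    rw [← hz] at this
    exact WithTop.coe_le_coe.1 this

open Classical in
/-- The block that contains the position `i`, counted from `1`. -/
noncomputable def blockAt (hn : 0 < n) (len : Fin n → ℕ) (i : ℕ) : Fin n :=
  if h : ∃ s, prefixSum len s < i ∧ i ≤ prefixSum len s + len s then h.choose else ⟨0, hn⟩

theorem blockAt_spec (hn : 0 < n) (len : Fin n → ℕ) {i : ℕ} (hi : 1 ≤ i) (hi' : i ≤ ∑ s, len s) :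
    prefixSum len (blockAt hn len i) < i ∧
      i ≤ prefixSum len (blockAt hn len i) + len (blockAt hn len i) := by
  have h : ∃ s, prefixSum len s < i ∧ i ≤ prefixSum len s + len s := by
    obtain ⟨s, h1, h2⟩ := exists_prefixSum_le_lt len (k := i - 1) (by omega)
    exact ⟨s, by omega, by omega⟩
  rw [blockAt, dif_pos h]
  exact h.choose_spec

theorem blockRangeMin_congr {f f' : Fin n → List ℤ} (hlen : blockLength f = blockLength f')
    (s : Fin n) (h : ∀ l < blockLength f s, blockEntry f s l = blockEntry f' s l) (i j : ℕ) :
    blockRangeMin f s i j = blockRangeMin f' s i j := by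
  rw [blockRangeMin, blockRangeMin, ← hlen]
  refine inf_congr rfl fun l hl => h l ?_
  rw [mem_filter, mem_range] at hl
  exact hl.1

/-- A range minimum is determined by the lengths and minima of all blocks, and the contributions
of the two blocks that contain the ends of the range. -/
theorem blocksRangeMin_congr (hn : 0 < n) {f f' : Fin n → List ℤ}
    (hlen : blockLength f = blockLength f') (hmin : blockMin f = blockMin f') {i j : ℕ}
    (hi : 1 ≤ i) (hij : i ≤ j) (hj : j ≤ ∑ s, blockLength f s)
    (h1 : blockRangeMin f (blockAt hn (blockLength f) i) i j =
      blockRangeMin f' (blockAt hn (blockLength f) i) i j)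
    (h2 : blockRangeMin f (blockAt hn (blockLength f) j) i j =
      blockRangeMin f' (blockAt hn (blockLength f) j) i j) :
    blocksRangeMin f i j = blocksRangeMin f' i j := by
  have hi' := blockAt_spec hn (blockLength f) hi (hij.trans hj)
  have hj' := blockAt_spec hn (blockLength f) (hi.trans hij) hj
  set bi := blockAt hn (blockLength f) i
  set bj := blockAt hn (blockLength f) j
  refine inf_congr rfl fun s _ => ?_
  by_cases hsi : s = bi
  · rw [hsi, h1]
  by_cases hsj : s = bj
  · rw [hsj, h2]
  by_cases hmid : bi < s ∧ s < bj
  · have a1 := prefixSum_add_le_of_lt (blockLength f) hmid.1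
    have a2 := prefixSum_add_le_of_lt (blockLength f) hmid.2
    have key : ((range (blockLength f s)).filter fun l =>
        i ≤ prefixSum (blockLength f) s + l + 1 ∧ prefixSum (blockLength f) s + l + 1 ≤ j) =
        range (blockLength f s) := by
      rw [filter_eq_self]
      intro l hl
      rw [mem_range] at hl
      constructor <;> omega
    have := congrFun hmin s
    rw [blockMin, blockMin, ← hlen] at this
    rw [blockRangeMin, blockRangeMin, ← hlen, key, this]
  · have key : ((range (blockLength f s)).filter fun l =>
        i ≤ prefixSum (blockLength f) s + l + 1 ∧ prefixSum (blockLength f) s + l + 1 ≤ j) = ∅ := by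
      rw [filter_eq_empty_iff]
      intro l hl
      rw [mem_range] at hl
      rcases lt_or_gt_of_ne hsi with h | h
      · have a1 := prefixSum_add_le_of_lt (blockLength f) h
        omega
      · have h' : bj < s := lt_of_le_of_ne (not_lt.1 fun h' => hmid ⟨h, h'⟩) (Ne.symm hsj)
        have a1 := prefixSum_add_le_of_lt (blockLength f) h'
        omega
    rw [blockRangeMin, blockRangeMin, ← hlen, key, inf_empty, inf_empty]

/-- The integers of absolute value below `V`, and `⊤`. -/
noncomputable def boundedValues (V : ℕ) : Finset (WithTop ℤ) :=
  insert ⊤ ((Ioo (-(V : ℤ)) V).map ⟨((↑) : ℤ → WithTop ℤ), WithTop.coe_injective⟩)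

theorem card_boundedValues_le {V : ℕ} (hV : 0 < V) : (boundedValues V).card ≤ 2 * V := by
  refine (card_insert_le _ _).trans ?_
  rw [card_map, Int.card_Ioo]
  omega

theorem top_mem_boundedValues (V : ℕ) : ⊤ ∈ boundedValues V := mem_insert_self _ _

/-- An infimum over a finite set is attained or empty; the second case is why `⊤` is among the
bounded values. All partial minima thus come from one small set and fit into boundedly many
messages. -/
theorem inf_mem_boundedValues {V : ℕ} {α : Type} (S : Finset α) (g : α → WithTop ℤ)
    (h : ∀ y ∈ S, g y ∈ boundedValues V) : S.inf g ∈ boundedValues V := by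
  rcases S.eq_empty_or_nonempty with rfl | hS
  · exact top_mem_boundedValues V
  · obtain ⟨y, hy, e⟩ := exists_mem_eq_inf S hS g
    rw [e]
    exact h y hy

theorem blockEntry_mem_boundedValues {V : ℕ} {f : Fin n → List ℤ}
    (h : ∀ s, ∀ y ∈ f s, |y| < V) (s : Fin n) (l : ℕ) : blockEntry f s l ∈ boundedValues V := by
  rw [blockEntry]
  cases hl : (f s)[l]? with
  | none => exact top_mem_boundedValues V
  | some y =>
    refine mem_insert_of_mem (mem_map.2 ⟨y, ?_, rfl⟩)
    rw [mem_Ioo, ← abs_lt]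
    exact h s y (List.mem_of_getElem? hl)

end BlockMinima

/-! ### Distribution of the items among virtual helpers -/

section Helpers

variable {n J : ℕ}

/-- The items of node `v` that concern block `s`. -/
def itemsOf (blk : Fin n × Fin J → Fin n) (v s : Fin n) : Finset (Fin n × Fin J) :=
  univ.filter fun i => i.1 = v ∧ blk i = s

/-- The number of items that concern block `s`. -/
def blockCount (blk : Fin n × Fin J → Fin n) (s : Fin n) : ℕ := ∑ v, (itemsOf blk v s).card

/-- The number of an item if all items are enumerated block by block, and node by node within a
block. -/
noncomputable def itemRank (blk : Fin n × Fin J → Fin n) (i : Fin n × Fin J) : ℕ :=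
  prefixSum (blockCount blk) (blk i) +
    (prefixSum (fun v => (itemsOf blk v (blk i)).card) i.1 + enumRank (itemsOf blk i.1 (blk i)) i)

/-- The number of the virtual helper that handles an item. A virtual helper handles at most `n`
items, which all concern the same block. -/
noncomputable def helper (blk : Fin n × Fin J → Fin n) (i : Fin n × Fin J) : ℕ :=
  blk i + itemRank blk i / n

open Classical in
/-- The block that a virtual helper is responsible for. -/
noncomputable def helperBlock (hn : 0 < n) (cnt : Fin n → ℕ) (e : ℕ) : Fin n :=
  if h : ∃ s : Fin n, ∃ g, prefixSum cnt s ≤ g ∧ g < prefixSum cnt s + cnt s ∧ s + g / n = e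
  then h.choose else ⟨0, hn⟩

variable (blk : Fin n × Fin J → Fin n)

theorem mem_itemsOf (i : Fin n × Fin J) : i ∈ itemsOf blk i.1 (blk i) := by simp [itemsOf]

theorem sum_blockCount : ∑ s, blockCount blk s = n * J := by
  have : (univ : Finset (Fin n × Fin J)).card = n * J := by simp
  rw [← this, card_eq_sum_card_fiberwise (f := fun i => (blk i, i.1)) (t := univ)
    (fun _ _ => mem_coe.2 (mem_univ _)), Fintype.sum_prod_type]
  refine sum_congr rfl fun s _ => sum_congr rfl fun v _ => ?_
  rw [itemsOf]
  congr 1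
  ext i
  simp [and_comm]

theorem rank_in_block_lt (i : Fin n × Fin J) :
    prefixSum (fun v => (itemsOf blk v (blk i)).card) i.1 + enumRank (itemsOf blk i.1 (blk i)) i <
      blockCount blk (blk i) :=
  (Nat.add_lt_add_left (enumRank_lt (mem_itemsOf blk i)) _).trans_le
    (prefixSum_add_le (fun v => (itemsOf blk v (blk i)).card) i.1)

theorem itemRank_lt (i : Fin n × Fin J) : itemRank blk i < n * J := by
  have h1 := rank_in_block_lt blk i
  have h2 := prefixSum_add_le (blockCount blk) (blk i)
  rw [sum_blockCount] at h2
  rw [itemRank]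
  omega

/-- Inside a block the ranks of different nodes fill disjoint intervals, and `enumRank` separates
the items of one node. -/
theorem itemRank_injective {i i' : Fin n × Fin J} (hb : blk i = blk i')
    (h : itemRank blk i = itemRank blk i') : i = i' := by
  rw [itemRank, itemRank, hb, Nat.add_left_cancel_iff] at h
  have hi := enumRank_lt (mem_itemsOf blk i)
  have hi' := enumRank_lt (mem_itemsOf blk i')
  rw [hb] at hi
  have hv : i.1 = i'.1 := by
    rcases lt_trichotomy i.1 i'.1 with hv | hv | hv
    · have := prefixSum_add_le_of_lt (fun v => (itemsOf blk v (blk i')).card) hv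
      omega
    · exact hv
    · have := prefixSum_add_le_of_lt (fun v => (itemsOf blk v (blk i')).card) hv
      omega
  rw [hv, Nat.add_left_cancel_iff] at h
  refine enumRank_injOn ?_ (mem_itemsOf blk i') h
  rw [← hb, ← hv]
  exact mem_itemsOf blk i

/-- Ranks grow with the block, so `g / n` grows weakly and the summand `s` makes the growth strict.
This splits a chunk of `n` ranks that crosses a block boundary between different helpers. -/
theorem helper_block_lt {cnt : Fin n → ℕ} {s s' : Fin n} {g g' : ℕ}
    (hg : g < prefixSum cnt s + cnt s) (hg' : prefixSum cnt s' ≤ g') (hs : s < s') :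
    (s : ℕ) + g / n < s' + g' / n := by
  have := prefixSum_add_le_of_lt cnt hs
  exact add_lt_add_of_lt_of_le hs (Nat.div_le_div_right (by omega))

theorem helper_block_unique {cnt : Fin n → ℕ} {s s' : Fin n} {g g' : ℕ}
    (h1 : prefixSum cnt s ≤ g) (h2 : g < prefixSum cnt s + cnt s)
    (h1' : prefixSum cnt s' ≤ g') (h2' : g' < prefixSum cnt s' + cnt s')
    (h : (s : ℕ) + g / n = s' + g' / n) : s = s' := by
  rcases lt_trichotomy s s' with hs | hs | hs
  · exact absurd h (helper_block_lt h2 h1' hs).ne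
  · exact hs
  · exact absurd h (helper_block_lt h2' h1 hs).ne'

theorem itemRank_mem_block (i : Fin n × Fin J) :
    prefixSum (blockCount blk) (blk i) ≤ itemRank blk i ∧
      itemRank blk i < prefixSum (blockCount blk) (blk i) + blockCount blk (blk i) :=
  ⟨Nat.le_add_right _ _, Nat.add_lt_add_left (rank_in_block_lt blk i) _⟩

/-- The block of an item can be recovered from its helper number by anyone who knows the block
counts. -/
theorem helperBlock_helper (hn : 0 < n) (i : Fin n × Fin J) :
    helperBlock hn (blockCount blk) (helper blk i) = blk i := by
  have hi := itemRank_mem_block blk i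
  have hex : ∃ s : Fin n, ∃ g, prefixSum (blockCount blk) s ≤ g ∧
      g < prefixSum (blockCount blk) s + blockCount blk s ∧ s + g / n = helper blk i :=
    ⟨blk i, itemRank blk i, hi.1, hi.2, rfl⟩
  rw [helperBlock, dif_pos hex]
  obtain ⟨g, h1, h2, h3⟩ := hex.choose_spec
  exact helper_block_unique h1 h2 hi.1 hi.2 h3

theorem helper_lt (i : Fin n × Fin J) : helper blk i < n + J := by
  have h1 := (blk i).2
  have h2 := Nat.div_lt_of_lt_mul (itemRank_lt blk i)
  rw [helper]
  omega

/-- A residue class contains at most `c` helper numbers. The helper determines the block and so the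
quotient of the rank by `n`; hence the remainder of the rank identifies the item. -/
theorem card_helper_mod_le {c : ℕ} (hn : 0 < n) (hc : n + J ≤ c * n) (k : ℕ) :
    (univ.filter fun i => helper blk i % n = k).card ≤ c * n := by
  have := card_le_card_of_injOn (s := univ.filter fun i => helper blk i % n = k)
    (t := range c ×ˢ range n) (fun i => (helper blk i / n, itemRank blk i % n)) ?_ ?_
  · simpa using this
  · intro i _
    simp only [coe_product, Set.mem_prod, mem_coe, mem_range]
    exact ⟨Nat.div_lt_of_lt_mul (by have := helper_lt blk i; rw [mul_comm]; omega),
      Nat.mod_lt _ hn⟩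
  · intro i hi j hj hij
    simp only [mem_coe, mem_filter, mem_univ, true_and] at hi hj
    simp only [Prod.mk.injEq] at hij
    have hh : helper blk i = helper blk j := by
      rw [← Nat.div_add_mod (helper blk i) n, ← Nat.div_add_mod (helper blk j) n, hij.1, hi, hj]
    have hb : blk i = blk j := helper_block_unique (itemRank_mem_block blk i).1
      (itemRank_mem_block blk i).2 (itemRank_mem_block blk j).1 (itemRank_mem_block blk j).2 hh
    rw [helper, helper, hb, Nat.add_left_cancel_iff] at hh
    refine itemRank_injective blk hb ?_
    rw [← Nat.div_add_mod (itemRank blk i) n, ← Nat.div_add_mod (itemRank blk j) n, hh, hij.2]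

end Helpers

/-! ### The range minimum protocol -/

/-- The conditions on the global input of the range minimum problem: each of the `n` nodes holds
at most `a * n` entries of absolute value below `V`, and at most `q * n` valid queries. -/
structure RMQValid (n a q V : ℕ) (x : Fin n → RMQNodeInput) : Prop where
  entries : ∀ s, ∀ y ∈ (x s).subarray, |y| < (V : ℤ)
  length_le : ∀ v, (x v).subarray.length ≤ a * n
  queries_le : ∀ v, (x v).queries.length ≤ q * n
  range : ∀ v, ∀ p ∈ (x v).queries, 1 ≤ p.1 ∧ p.1 ≤ p.2 ∧
    p.2 ≤ (List.ofFn fun v => (x v).subarray).flatten.length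

/-- The number of rounds of the range minimum protocol. -/
def rmqRounds (a q w : ℕ) : ℕ :=
  (a + w + 2) + (2 * q + 1) + 2 * (2 * q + 2) + (w + 1) * a + (w + 1) * ((2 * q + 1) * a)
    + (40 * (2 * a + 4 * q + 14) + 72 * ((2 * q + 1) * (2 * a + 4 * q + 14)))
    + (40 * (2 * q + w + 13) + 72 * ((2 * q + 1) * (2 * q + w + 13)))

section Protocol

variable {n a q V b : ℕ}

/-- The blocks of the array of a valid input. -/
def rmqBlocks (x : {x // RMQValid n a q V x}) (v : Fin n) : List ℤ := (x.1 v).subarray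

/-- The query that an item belongs to. Every query `t` gives rise to the items `2 * t` and
`2 * t + 1`. -/
def itemQuery (x : {x // RMQValid n a q V x}) (i : Fin n × Fin (2 * (q * n))) : ℕ × ℕ :=
  ((x.1 i.1).queries[(i.2 : ℕ) / 2]?).getD (0, 0)

/-- The block that an item concerns: the one that contains the left, respectively right, end of the
query. -/
noncomputable def itemBlock (hn : 0 < n) (x : {x // RMQValid n a q V x})
    (i : Fin n × Fin (2 * (q * n))) : Fin n :=
  blockAt hn (blockLength (rmqBlocks x))
    (if (i.2 : ℕ) % 2 = 0 then (itemQuery x i).1 else (itemQuery x i).2)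

/-- The answer to an item: the contribution of its block to the range minimum. -/
noncomputable def itemAnswer (hn : 0 < n) (x : {x // RMQValid n a q V x})
    (i : Fin n × Fin (2 * (q * n))) : WithTop ℤ :=
  blockRangeMin (rmqBlocks x) (itemBlock hn x i) (itemQuery x i).1 (itemQuery x i).2

/-- The answers of a node to its queries. -/
noncomputable def rmqAnswer (x : {x // RMQValid n a q V x}) (v : Fin n) : List ℤ :=
  (x.1 v).queries.map fun p => (blocksRangeMin (rmqBlocks x) p.1 p.2).untopD 0

theorem rmqAnswer_spec (x : {x // RMQValid n a q V x}) (v : Fin n) :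
    List.Forall₂ (fun p z => IsRangeMin (List.ofFn fun v => (x.1 v).subarray).flatten p.1 p.2 z)
      (x.1 v).queries (rmqAnswer x v) := by
  rw [rmqAnswer, List.forall₂_map_right_iff, List.forall₂_same]
  intro p hp
  obtain ⟨h1, h2, h3⟩ := x.2.range v p hp
  exact isRangeMin_blocksRangeMin _ h1 h2 h3

theorem rmqAnswer_congr (hn : 0 < n) {x x' : {x // RMQValid n a q V x}} {v : Fin n}
    (hx : x.1 v = x'.1 v) (hlen : blockLength (rmqBlocks x) = blockLength (rmqBlocks x'))
    (hmin : blockMin (rmqBlocks x) = blockMin (rmqBlocks x'))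
    (hans : ∀ j, itemAnswer hn x (v, j) = itemAnswer hn x' (v, j)) :
    rmqAnswer x v = rmqAnswer x' v := by
  rw [rmqAnswer, rmqAnswer, ← hx]
  refine List.map_congr_left fun p hp => ?_
  obtain ⟨h1, h2, h3⟩ := x.2.range v p hp
  obtain ⟨t, ht, rfl⟩ := List.getElem_of_mem hp
  have hq := x.2.queries_le v
  have e1 : (2 * t + 1) / 2 = t := by omega
  have e2 : 2 * t / 2 = t := by omega
  have a1 := hans ⟨2 * t, by omega⟩
  have a2 := hans ⟨2 * t + 1, by omega⟩
  simp only [itemAnswer, itemBlock, itemQuery, ← hx, ← hlen, e1, e2,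
    List.getElem?_eq_getElem ht, Option.getD_some, Nat.mul_mod_right, if_true] at a1 a2
  rw [if_neg (by omega)] at a2
  rw [blocksRangeMin_congr hn hlen hmin h1 h2 (h3.trans (length_flatten_ofFn _).le) a1 a2]

theorem itemQuery_le (x : {x // RMQValid n a q V x}) (i : Fin n × Fin (2 * (q * n))) :
    (itemQuery x i).1 ≤ n * (a * n) ∧ (itemQuery x i).2 ≤ n * (a * n) := by
  have htot : (List.ofFn fun v => (x.1 v).subarray).flatten.length ≤ n * (a * n) := by
    rw [length_flatten_ofFn]
    refine (sum_le_card_nsmul _ _ (a * n) fun s _ => x.2.length_le s).trans ?_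
    simp
  rw [itemQuery]
  cases h : (x.1 i.1).queries[(i.2 : ℕ) / 2]? with
  -- A padding item, beyond the list of queries of its node, carries the default query `(0, 0)`; its
  -- answer is never used.
  | none => simp
  | some p =>
    have := x.2.range i.1 p (List.mem_of_getElem? h)
    simp only [Option.getD_some]
    omega

/-- Global inputs range over valid inputs only, so the promise is built into the notion of
knowledge. The hypotheses on `b` make `n`, constants and entries fit into a number of messages that
does not depend on `n`. -/
theorem rmq_reach (hn : 0 < n) (w : ℕ) (hnb : n ≤ 2 ^ b) (hb : 1 ≤ b) (hV : 0 < V)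
    (hVb : V ≤ 2 ^ (w * b)) :
    ∃ E, Reach b (fun x : {x // RMQValid n a q V x} => x.1)
      (rmqRounds a q w) E ∧
      ∀ v x x', E v x x' → rmqAnswer x v = rmqAnswer x' v := by
  classical
  -- numeric bounds
  have hconst : ∀ c : ℕ, c + 1 ≤ 2 ^ (c * b) := fun c =>
    (Nat.lt_two_pow_self (n := c)).trans_le
      (Nat.pow_le_pow_right two_pos (Nat.le_mul_of_pos_right _ hb))
  have hn1 : n ≤ 2 ^ (1 * b) := by rwa [one_mul]
  have hmul : ∀ {y z s t : ℕ}, y ≤ 2 ^ (s * b) → z ≤ 2 ^ (t * b) → y * z ≤ 2 ^ ((s + t) * b) := by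
    intro y z s t hy hz
    rw [add_mul, pow_add]
    exact Nat.mul_le_mul hy hz
  have hmono : ∀ {y s t : ℕ}, y ≤ 2 ^ (s * b) → s ≤ t → y ≤ 2 ^ (t * b) := fun hy hst =>
    hy.trans (Nat.pow_le_pow_right two_pos (Nat.mul_le_mul_right _ hst))
  have hlin : ∀ c : ℕ, c * n + 1 ≤ 2 ^ ((c + 1) * b) := fun c =>
    le_trans (by nlinarith) (hmul (hconst c) hn1)
  have h2V : (boundedValues V).card ≤ 2 ^ ((w + 1) * b) := by
    refine (card_boundedValues_le hV).trans ?_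
    rw [add_comm w 1]
    exact hmul (hconst 1) hVb
  set J := 2 * (q * n) with hJ
  have hJb : J + 1 ≤ 2 ^ ((2 * q + 1) * b) := by
    have := hlin (2 * q)
    rwa [mul_assoc] at this
  have hJc : n + J ≤ (2 * q + 1) * n := by rw [hJ]; apply le_of_eq; ring
  have hnJ : n * J + 1 ≤ 2 ^ ((1 + (2 * q + 1)) * b) := le_trans (by nlinarith) (hmul hn1 hJb)
  have hVentry : ∀ (x : {x // RMQValid n a q V x}) s l,
      blockEntry (rmqBlocks x) s l ∈ boundedValues V := fun x =>
    blockEntry_mem_boundedValues x.2.entries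
  let blk : {x // RMQValid n a q V x} → Fin n × Fin J → Fin n := itemBlock hn
  -- broadcast of lengths and minima
  have s1 := Extends.exchange (b := b)
    (E := fun v (x x' : {x // RMQValid n a q V x}) => x.1 v = x'.1 v)
    (a + 1 + (w + 1))
    (fun x u _ => (blockLength (rmqBlocks x) u, blockMin (rmqBlocks x) u))
    (range (a * n + 1) ×ˢ boundedValues V)
    (fun x u _ => by
      rw [mem_product, mem_range, Nat.lt_succ_iff]
      exact ⟨x.2.length_le u, inf_mem_boundedValues (range _) _ fun l _ => hVentry x u l⟩)
    (by rw [card_product, card_range]; exact hmul (hlin a) h2V)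
    (fun u x x' e _ => by
      have h : rmqBlocks x u = rmqBlocks x' u := congrArg RMQNodeInput.subarray e
      have h' : blockEntry (rmqBlocks x) u = blockEntry (rmqBlocks x') u := by
        funext l
        simp only [blockEntry, h]
      simp only [blockLength, blockMin, h, h'])
  -- numbers of items
  have hblk : ∀ {v : Fin n} {x x' : {x // RMQValid n a q V x}} {i : Fin n × Fin J},
      x.1 v = x'.1 v → blockLength (rmqBlocks x) = blockLength (rmqBlocks x') → i.1 = v →
      itemQuery x i = itemQuery x' i ∧ blk x i = blk x' i := by
    rintro v x x' i e hlen rfl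
    have : itemQuery x i = itemQuery x' i := by simp only [itemQuery, e]
    exact ⟨this, by simp only [blk, itemBlock, this, hlen]⟩
  have hitems : ∀ {v : Fin n} {x x' : {x // RMQValid n a q V x}},
      x.1 v = x'.1 v → blockLength (rmqBlocks x) = blockLength (rmqBlocks x') → ∀ s,
      itemsOf (blk x) v s = itemsOf (blk x') v s := by
    intro v x x' e hlen s
    refine filter_congr fun i _ => and_congr_right fun hi => ?_
    rw [(hblk e hlen hi).2]
  have hfst : ∀ u, (univ.filter fun i : Fin n × Fin J => i.1 = u).card ≤ J := by
    intro u
    have := card_le_card_of_injOn (s := univ.filter fun i : Fin n × Fin J => i.1 = u)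
      (t := (univ : Finset (Fin J))) Prod.snd (fun _ _ => mem_coe.2 (mem_univ _)) ?_
    · simpa using this
    · intro i hi j hj hij
      simp only [mem_coe, mem_filter, mem_univ, true_and] at hi hj
      exact Prod.ext (hi.trans hj.symm) hij
  have hcard : ∀ x v s, (itemsOf (blk x) v s).card ≤ J := fun x v s =>
    (card_le_card (monotone_filter_right _ fun _ _ hi => hi.1)).trans (hfst v)
  have hlen1 : ∀ {x x' : {x // RMQValid n a q V x}},
      (∀ u, (blockLength (rmqBlocks x) u, blockMin (rmqBlocks x) u) =
        (blockLength (rmqBlocks x') u, blockMin (rmqBlocks x') u)) →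
      blockLength (rmqBlocks x) = blockLength (rmqBlocks x') ∧
        blockMin (rmqBlocks x) = blockMin (rmqBlocks x') := fun h =>
    ⟨funext fun u => congrArg Prod.fst (h u), funext fun u => congrArg Prod.snd (h u)⟩
  -- Each node tells the owner of each block how many of its items concern that block.
  have s2 := s1.trans (Extends.exchange (b := b) (2 * q + 1)
    (fun x v s => (itemsOf (blk x) v s).card) (range (J + 1))
    (fun x v s => by rw [mem_range, Nat.lt_succ_iff]; exact hcard x v s)
    (by rw [card_range]; exact hJb)
    (fun v x x' e s => by rw [hitems e.1 (hlen1 e.2).1]))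
  have hcount : ∀ x s, blockCount (blk x) s ≤ n * J := fun x s =>
    (single_le_sum (f := blockCount (blk x)) (fun _ _ => Nat.zero_le _) (mem_univ s)).trans
      (sum_blockCount _).le
  -- The owner of `s` returns where the items of `v` start among those of `s`, and their total
  -- number. With the totals of all blocks, `v` can compute the ranks of its own items.
  have s3 := s2.trans (Extends.exchange (b := b) ((1 + (2 * q + 1)) + (1 + (2 * q + 1)))
    (fun x s v => (prefixSum (fun v' => (itemsOf (blk x) v' s).card) v, blockCount (blk x) s))
    (range (n * J + 1) ×ˢ range (n * J + 1))
    (fun x s v => by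
      rw [mem_product, mem_range, mem_range, Nat.lt_succ_iff, Nat.lt_succ_iff]
      refine ⟨le_trans ?_ (hcount x s), hcount x s⟩
      exact (Nat.le_add_right _ _).trans (prefixSum_add_le _ v))
    (by rw [card_product, card_range]; exact hmul hnJ hnJ)
    (fun s x x' e v => by simp only [blockCount, e.2]))
  -- distribution of the blocks
  have s4 := s3.trans (Extends.exchange (b := b) ((w + 1) * a)
    (fun x s (r : Fin n) (f : Fin a) => blockEntry (rmqBlocks x) s (r + f * n))
    (Fintype.piFinset fun _ => boundedValues V)
    (fun x s r => by simp [Fintype.mem_piFinset, hVentry])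
    (by
      rw [Fintype.card_piFinset, prod_const, card_univ, mul_right_comm, pow_mul]
      simpa using Nat.pow_le_pow_left h2V _)
    (fun s x x' e r => by
      have : rmqBlocks x s = rmqBlocks x' s := congrArg RMQNodeInput.subarray e.1.1.1
      simp only [blockEntry, this]))
  -- Node `r` now has the entries of all blocks at positions congruent to `r` modulo `n`. Node `h`
  -- plays the helpers `h + f.1 * n` and receives from every `r` its share of their blocks, hence
  -- these blocks entirely.
  have s5 := s4.trans (Extends.exchange (b := b) ((w + 1) * ((2 * q + 1) * a))
    (fun x (r : Fin n) (h : Fin n) (f : Fin (2 * q + 1) × Fin a) => blockEntry (rmqBlocks x)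
      (helperBlock hn (blockCount (blk x)) (h + f.1 * n)) (r + f.2 * n))
    (Fintype.piFinset fun _ => boundedValues V)
    (fun x s r => by simp [Fintype.mem_piFinset, hVentry])
    (by
      rw [Fintype.card_piFinset, prod_const, card_univ, mul_right_comm, pow_mul]
      simpa using Nat.pow_le_pow_left h2V _)
    (fun r x x' e h => by
      have hc : blockCount (blk x) = blockCount (blk x') :=
        funext fun s => congrArg Prod.snd (e.1.2 s)
      funext f
      rw [hc]
      exact congrFun (e.2 (helperBlock hn (blockCount (blk x')) (h + f.1 * n))) f.2))
  obtain ⟨E₀, hE₀, hknow⟩ : ∃ E₀, Extends b _ _ E₀ ∧ ∀ v x x', E₀ v x x' → x.1 v = x'.1 v ∧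
      blockLength (rmqBlocks x) = blockLength (rmqBlocks x') ∧
      blockMin (rmqBlocks x) = blockMin (rmqBlocks x') ∧
      (∀ s, prefixSum (fun v' => (itemsOf (blk x) v' s).card) v =
        prefixSum (fun v' => (itemsOf (blk x') v' s).card) v) ∧
      blockCount (blk x) = blockCount (blk x') ∧
      ∀ (r : Fin n) (f : Fin (2 * q + 1) × Fin a),
        blockEntry (rmqBlocks x) (helperBlock hn (blockCount (blk x)) (v + f.1 * n))
          (r + f.2 * n) =
        blockEntry (rmqBlocks x') (helperBlock hn (blockCount (blk x')) (v + f.1 * n))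
          (r + f.2 * n) :=
    ⟨_, s5, fun v x x' e => ⟨e.1.1.1.1.1, (hlen1 e.1.1.1.1.2).1, (hlen1 e.1.1.1.1.2).2,
      fun s => congrArg Prod.fst (e.1.1.2 s), funext fun s => congrArg Prod.snd (e.1.1.2 s),
      fun r => congrFun (e.2 r)⟩⟩
  -- routing of the items to the helpers
  let dest : {x // RMQValid n a q V x} → Fin n × Fin J → Fin n := fun x i =>
    ⟨helper (blk x) i % n, Nat.mod_lt _ hn⟩
  have hfst' := fun u => (hfst u).trans ((Nat.le_add_left J n).trans hJc)
  have hdest : ∀ x u, (univ.filter fun i => dest x i = u).card ≤ (2 * q + 1) * n := by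
    intro x u
    refine le_trans (card_le_card ?_) (card_helper_mod_le (blk x) hn hJc u)
    intro i hi
    simp only [mem_filter, mem_univ, true_and] at hi ⊢
    rw [← hi]
  let W := (range (n * (a * n) + 1) ×ˢ range (n * (a * n) + 1)) ×ˢ range (n + J)
  have hWcard : W.card ≤ 2 ^ (((1 + (a + 1)) + (1 + (a + 1)) + (2 * q + 2)) * b) := by
    simp only [W, card_product, card_range]
    have h1 : n * (a * n) + 1 ≤ 2 ^ ((1 + (a + 1)) * b) :=
      le_trans (by nlinarith) (hmul hn1 (hlin a))
    refine hmul (hmul h1 h1) ?_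
    exact (hJc.trans (Nat.le_succ _)).trans (hlin (2 * q + 1))
  have hWpos : 0 < W.card := by
    refine card_pos.2 ⟨((0, 0), 0), ?_⟩
    simp only [W, mem_product, mem_range]
    omega
  have hroute : ∀ {y s : ℕ}, 0 < y → y ≤ 2 ^ (s * b) →
      Fintype.card (Fin n × Fin J) * (n * y) + 1 ≤ 2 ^ ((1 + (2 * q + 1) + (1 + s)) * b) := by
    intro y s hy hys
    refine le_trans ?_ (hmul hnJ (hmul hn1 hys))
    have : 0 < n * y := Nat.mul_pos hn hy
    rw [Fintype.card_prod, Fintype.card_fin, Fintype.card_fin]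
    nlinarith
  -- The factor `10` comes from `Held.route`. It is rounded up to `16`, which four messages of at
  -- least one bit can encode.
  have hten : 10 * (2 * q + 1) * n + 1 ≤ 2 ^ ((4 + (2 * q + 1) + 1) * b) := by
    have h16 : 16 ≤ 2 ^ (4 * b) := by
      calc 16 = 2 ^ (4 * 1) := by norm_num
        _ ≤ _ := Nat.pow_le_pow_right two_pos (Nat.mul_le_mul_left _ hb)
    have := hmul (hmul h16 (hconst (2 * q + 1))) hn1
    refine le_trans ?_ this
    nlinarith
  have H₀ : Held E₀ (fun (_ : {x // RMQValid n a q V x}) (i : Fin n × Fin J) => i.1)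
      (fun x i => (itemQuery x i, helper (blk x) i)) := by
    intro u x x' e i
    obtain ⟨e1, e2, -, e4, e5, -⟩ := hknow u x x' e
    refine ⟨Iff.rfl, fun hu => ?_⟩
    obtain ⟨hq, hb⟩ := hblk e1 e2 hu
    simp only [hq, helper, itemRank, hb, hu, e4, e5, hitems e1 e2]
  -- The value of `s` need only be at least the exponents in `hroute` and `hten`; the same holds for
  -- the way back.
  obtain ⟨E₁, hE₁, H₁⟩ := Held.route (b := b) (c := 2 * q + 1) (s := 2 * a + 4 * q + 14)
    (dest := dest) (p := fun x i => (itemQuery x i, helper (blk x) i)) hn (Nat.succ_pos _) W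
    (fun x i => by
      have h1 := itemQuery_le x i
      have h2 := helper_lt (blk x) i
      simp only [W, mem_product, mem_range]
      omega)
    (hmono (hroute hWpos hWcard) (by omega)) (hmono hten (by omega))
    (fun _ => hfst') hdest
    (H₀.map fun y => ((⟨y.2 % n, Nat.mod_lt _ hn⟩ : Fin n), y))
  -- the answers of the helpers, and their way back
  have H₁' : Held E₁ dest (fun x i => (i.1, itemAnswer hn x i)) := by
    intro u x x' e i
    have hi := H₁ u x x' e i
    refine ⟨hi.1, fun hu => ?_⟩
    have hp := hi.2 hu
    simp only [Prod.mk.injEq] at hp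
    obtain ⟨-, e2, -, -, e5, e6⟩ := hknow u x x' (hE₁.1 _ _ _ e)
    -- The payload does not name the block; the receiver deduces it from the helper number and the
    -- block counts.
    have hb : itemBlock hn x i = itemBlock hn x' i := by
      change blk x i = blk x' i
      rw [← helperBlock_helper (blk x) hn i, ← helperBlock_helper (blk x') hn i, hp.2, e5]
    have hmod : (u : ℕ) + helper (blk x) i / n * n = helper (blk x) i := by
      rw [← hu]
      exact Nat.mod_add_div' _ _
    have hdiv : helper (blk x) i / n < 2 * q + 1 :=
      Nat.div_lt_of_lt_mul (by have := helper_lt (blk x) i; rw [mul_comm]; omega)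
    have hans : itemAnswer hn x i = itemAnswer hn x' i := by
      rw [itemAnswer, itemAnswer, ← hb, ← hp.1]
      refine blockRangeMin_congr e2 _ (fun l hl => ?_) _ _
      have hl' : l / n < a := Nat.div_lt_of_lt_mul (by
        rw [mul_comm]
        exact hl.trans_le (x.2.length_le _))
      have := e6 ⟨l % n, Nat.mod_lt _ hn⟩ (⟨_, hdiv⟩, ⟨_, hl'⟩)
      simp only [hmod, Nat.mod_add_div', ← e5, helperBlock_helper] at this
      exact this
    simp only [hans]
  obtain ⟨E₂, hE₂, H₂⟩ := Held.route (b := b) (c := 2 * q + 1) (s := 2 * q + w + 13)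
    (dest := fun (_ : {x // RMQValid n a q V x}) i => i.1) (p := itemAnswer hn) hn
    (Nat.succ_pos _) (boundedValues V)
    (fun x i => by
      rw [itemAnswer, blockRangeMin]
      exact inf_mem_boundedValues _ _ fun l _ => hVentry x _ l)
    (hmono (hroute (card_pos.2 ⟨_, top_mem_boundedValues V⟩) h2V) (by omega))
    (hmono hten (by omega)) hdest (fun _ => hfst') H₁'
  refine ⟨E₂, ?_, ?_⟩
  · have := ((hE₀.trans hE₁).trans hE₂).2 _ _ _
      (Reach.input fun x : {x // RMQValid n a q V x} => x.1)
    convert this using 1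
    rw [rmqRounds]
    ring
  · intro v x x' e
    obtain ⟨e1, e2, e3, -⟩ := hknow v x x' (hE₁.1 _ _ _ (hE₂.1 _ _ _ e))
    exact rmqAnswer_congr hn e1 e2 e3 fun j => (H₂ v x x' e (v, j)).2 rfl

end Protocol

theorem mainTheorem6 (a q w β : ℕ) (hβ : 1 ≤ β) :
    ∃ R : ℕ, ∀ n : ℕ,
      ∃ alg : CliqueAlgorithm n (β * wordBits n) RMQNodeInput (List ℤ),
        ∀ (A : List ℤ) (x : Fin n → RMQNodeInput),
          A = (List.ofFn fun v => (x v).subarray).flatten →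
          (∀ y ∈ A, |y| < 2 ^ (w * wordBits n)) →
          (∀ v, (x v).subarray.length ≤ a * n) →
          (∀ v, (x v).queries.length ≤ q * n) →
          (∀ v, ∀ p ∈ (x v).queries, 1 ≤ p.1 ∧ p.1 ≤ p.2 ∧ p.2 ≤ A.length) →
          ∀ v, List.Forall₂ (fun p z => IsRangeMin A p.1 p.2 z)
            (x v).queries (alg.outputAfter x R v) := by
  refine ⟨rmqRounds a q w, fun n => ?_⟩
  rcases Nat.eq_zero_or_pos n with rfl | hn
  · exact ⟨⟨Unit, fun _ _ => (), fun _ _ _ _ _ => false, fun _ _ _ _ => (), fun _ _ => []⟩,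
      fun _ _ _ _ _ _ _ v => v.elim0⟩
  have hL : wordBits n ≤ β * wordBits n := Nat.le_mul_of_pos_left _ hβ
  obtain ⟨E, hE, hout⟩ := rmq_reach (a := a) (q := q) (V := 2 ^ (w * wordBits n))
    (b := β * wordBits n) hn w
    ((Nat.lt_pow_succ_log_self one_lt_two n).le.trans (Nat.pow_le_pow_right two_pos hL))
    (le_trans (Nat.succ_pos _) hL) (by positivity)
    (Nat.pow_le_pow_right two_pos (Nat.mul_le_mul_left _ hL))
  -- Only valid inputs enter the choice of the algorithm; what it outputs on other inputs is
  -- irrelevant.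
  obtain ⟨alg, halg⟩ := hE.exists_output rmqAnswer hout
  refine ⟨alg, ?_⟩
  rintro A x rfl h1 h2 h3 h4 v
  have hx : RMQValid n a q (2 ^ (w * wordBits n)) x := by
    refine ⟨fun s y hy => ?_, h2, h3, h4⟩
    push_cast
    exact h1 y (List.mem_flatten.2 ⟨_, List.mem_ofFn.2 ⟨s, rfl⟩, hy⟩)
  rw [halg ⟨x, hx⟩ v]
  exact rmqAnswer_spec ⟨x, hx⟩ v
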